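/- **Tiles and assemblies.** Fix an alphabet $\Sigma$. A tile type is a quadruple of glues in $\Sigma^*\times\mathbb N$ (label, strength), one for each side of a unit square; $T$ is a finite set of tile types. A configuration is a partial function $\alpha:\mathbb Z^2\dashrightarrow T$. Its binding graph $G_\alpha$ has vertex set $\operatorname{dom}\alpha$ and an edge between adjacent points whose tiles have, on their opposing sides, equal glues of positive strength. All systems have temperature $1$: an assembly (a non-empty connected configuration) is stable if every cut of $G_\alpha$ has weight at least $1$. Write $\alpha\sqsubseteq\beta$ if $\beta$ extends $\alpha$; $\alpha$ and $\beta$ agree if they coincide on $\operatorname{dom}\alpha\cap\operatorname{dom}\beta$; $\alpha\to_1\beta$ if $\alpha,\beta$ are stable, $\alpha\sqsubseteq\beta$ and $\beta=\alpha+(\vec p,t)$ has exactly one more tile. An assembly sequence is a finite or infinite sequence with consecutive terms related by $\to_1$; its result is the union of its terms. A finite sequence terminates at the point of its last attachment (at the unique point of its first term, if that is a single tile and there is no attachment). Let $\mathcal T=(T,\sigma,1)$ with $\operatorname{dom}\sigma=\{\vec s\}$. $\mathcal T$-producing sequences are those starting with $\sigma$; $\mathcal A[\mathcal T]$ is the set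 of their results; the elements of $\mathcal A[\mathcal T]$ to which no tile can attach are terminal. Paths are finite simple paths, viewed as lists of points $\pi[1],\dots,\pi[|\pi|]$, and $|\pi|$ is the number of points. **Competing paths.** Let $\vec x\ne\vec y$ and let $\pi,\pi'$ be simple paths from $\vec x$ to $\vec y$ in the grid $\mathbb Z^2$. They are competing for $\vec y$ from $\vec x$ if: (1) $\pi\neq\pi'$; (2) they share only the points $\vec x,\vec y$; (3) one of them is a path in $G_\alpha$ for some $\alpha\in\mathcal A[\mathcal T]$; (4) for all $\alpha\in\mathcal A[\mathcal T]$, $p\in\{\pi,\pi'\}$, $1\le j<|p|$ and every simple path $p'$ from $\vec s$ to $p[j]$ in $G_\alpha$: if $p'$ goes through $\vec x$ then $p[1\ldots j]$ is a suffix of $p'$, and otherwise $p'$ is a prefix of every simple path from $\vec s$ to $\vec x$ in $G_\alpha$; (5) for all $\alpha\in\mathcal A[\mathcal T]$, every simple path from $\vec s$ to $\vec y$ in $G_\alpha$ has $\pi$ or $\pi'$ as a suffix; (6) for all $\alpha\in\mathcal A[\mathcal T]$ with $\vec x\in\operatorname{dom}\alpha$: (a) for each $p\in\{\pi,\pi'\}$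 there is a finite assembly sequence starting with the single tile $\{(\vec x,\alpha(\vec x))\}$ whose result has domain $\operatorname{dom}p$ and has $p$ as a path in its binding graph; (b) for every finite assembly sequence starting with $\{(\vec x,\alpha(\vec x))\}$, every simple path from $\vec x$ to $\vec y$ in the binding graph of its result is $\pi$ or $\pi'$. Then $\vec y$ is a point of competition (POC) with starting point $\vec x$. Let $P$ be the set of all POCs and $S_P$ the set of all their starting points. **Sequential non-determinism.** $\mathcal T$ is directionally deterministic if for every point $\vec p\ne\vec s$ in the domain of a producible assembly and all attachments $\alpha'=\alpha+(\vec p,t_\alpha)$, $\beta'=\beta+(\vec p,t_\beta)$ with $\alpha,\beta\in\mathcal A[\mathcal T]$ and $t_\alpha\ne t_\beta$: if $\vec p\in P$, then whenever the new tiles bind to tiles at $\vec p+\vec u$ (in $\alpha'$) and $\vec p+\vec u'$ (in $\beta'$), we have $\vec u\neq\vec u'$ or $\alpha(\vec p+\vec u)\ne\beta(\vec p+\vec u')$; if $\vec p\notin P$, then $\alpha$ and $\beta$ do not agree. Let $r\ge1$, let $Y=\{\vec y_1,\dots,\vec y_r\}\subseteq P$ consist of $r$ distinct POCs and let $w:Y\to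 T$. An $\alpha\in\mathcal A[\mathcal T]$ is $w$-correct if $\alpha=w$ on $Y\cap\operatorname{dom}\alpha$ and $\operatorname{dom}\alpha\cap(P\setminus Y)=\emptyset$. Assume that $\alpha$ is the unique $w$-correct terminal assembly with $Y\subseteq\operatorname{dom}\alpha$, and that $\mathcal T$ is $w$-sequentially non-deterministic: $\mathcal T$ is directionally deterministic; in every $\mathcal T$-producing sequence whose result contains $Y$ in its domain, the points $\vec y_1,\dots,\vec y_r$ receive tiles in this order; and $S_P\cap P=\emptyset$. **Competitions.** Let $\vec y\in Y$ with starting point $\vec x$ and competing paths $\pi_{\rm win},\pi_{\rm lose}$. The associated competition is the system $\mathcal C=(T,\{(\vec x,\alpha(\vec x))\},1)$. A winning assembly is a $\gamma\in\mathcal A[\mathcal C]$ such that $\pi_{\rm win}$ is a path in $G_\gamma$, $\gamma\sqsubseteq\alpha$, and every simple path in $G_\gamma$ starting at $\vec x$ is a prefix of $\pi_{\rm win}$ or $\pi_{\rm lose}$; that $\pi_{\rm win}$ is the winning path and $\pi_{\rm lose}$ the losing path means that such a $\gamma$ exists. A winning assembly sequence is a finite $\mathcal C$-producing sequence that terminates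 at $\vec y$ and whose result is a winning assembly. $\mathcal C$ is rigged in $\mathcal T$ if for every finite $\mathcal T$-producing sequence that terminates at $\vec x$ and whose result $\beta$ satisfies $\beta\sqsubseteq\alpha$ there is $1<j<|\pi_{\rm lose}|$ such that $\pi_{\rm lose}[j]\in\operatorname{dom}\beta$ and every simple path from $\vec s$ to $\vec x$ in $G_\beta$ goes through $\pi_{\rm lose}[j]$. Let $\mathcal M'_{\mathcal C}$ be the Markov chain whose states are the finite $\mathcal C$-producing sequences, starting from the one-term sequence, for which every simple path from $\vec x$ in the binding graph of the result is a prefix of $\pi_{\rm win}$ or $\pi_{\rm lose}$, and in which a state passes with equal probabilities to each of the states that extend it by one term. Define $\Pr[\mathcal C]=\sum_{\vec\gamma}\Pr_{\mathcal M'_{\mathcal C}}[\vec\gamma]$, summed over the winning assembly sequences $\vec\gamma$, where $\Pr_{\mathcal M'_{\mathcal C}}[\vec\gamma]$ is the product of the transition probabilities along the path from the root to $\vec\gamma$. **Corollary.** Let $|\pi_{\rm win}|=l\ge2$ and $|\pi_{\rm lose}|=l'\ge2$. If $\mathcal C$ is not rigged in $\mathcal T$, then $$\Pr[\mathcal C]=\sum_{i=0}^{l'-2}\binom{l+i-2}{l-2}\left(\frac12\right)^{l+i-1}.$$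 -/

import Mathlib

/-!
Two-dimensional abstract tile assembly at temperature `1` with a single seed tile: competing paths,
sequential non-determinism, competitions and their probabilities.
-/

noncomputable section

namespace TileAssembly

/-! ### Tiles, configurations, binding graphs -/

/-- The four sides of a unit square. -/
inductive Dir where
  | north : Dir
  | east : Dir
  | south : Dir
  | west : Dir

/-- The unit vector pointing to a side. -/
def Dir.vec : Dir → ℤ × ℤ
  | .north => (0, 1)
  | .east => (1, 0)
  | .south => (0, -1)
  | .west => (-1, 0)

/-- The opposite side. -/
def Dir.opp : Dir → Dir
  | .north => .south
  | .east => .west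
  | .south => .north
  | .west => .east

/-- A glue: a finite string over the alphabet `A` (the label) and a strength. -/
abbrev Glue (A : Type*) := List A × ℕ

/-- A tile type: one glue on each of the four sides. -/
abbrev TileType (A : Type*) := Dir → Glue A

/-- A configuration: a partial function from the integer lattice to tile types. -/
abbrev Config (A : Type*) := ℤ × ℤ → Option (TileType A)

/-- The full grid graph of the integer lattice: points at Euclidean distance `1`. -/
def gridGraph : SimpleGraph (ℤ × ℤ) where
  Adj p q := (p.1 - q.1) ^ 2 + (p.2 - q.2) ^ 2 = 1
  symm := ⟨fun p q h => by
    have h' : (p.1 - q.1) ^ 2 + (p.2 - q.2) ^ 2 = 1 := h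
    show (q.1 - p.1) ^ 2 + (q.2 - p.2) ^ 2 = 1
    linarith [h', sq_nonneg (p.1 - q.1)]⟩
  loopless := ⟨fun p h => by simp at h⟩

/-- The domain (shape) of a configuration. -/
def dom {A : Type*} (α : Config A) : Set (ℤ × ℤ) := {p | α p ≠ none}

/-- Two configurations agree if they coincide on the intersection of their domains. -/
def Agree {A : Type*} (α β : Config A) : Prop := ∀ p, p ∈ dom α → p ∈ dom β → α p = β p

/-- `α` is a subassembly of `β`. -/
def Sub {A : Type*} (α β : Config A) : Prop := dom α ⊆ dom β ∧ Agree α β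

/-- The restriction of `α` to the single point `x`. -/
def single {A : Type*} (α : Config A) (x : ℤ × ℤ) : Config A := fun p => if p = x then α x else none

/-- Tiles of types `t` and `t'` bind when the second one is next to the first one in direction `d`:
the glues on the opposing sides are equal and have positive strength. -/
def TilesBind {A : Type*} (t t' : TileType A) (d : Dir) : Prop := t d = t' d.opp ∧ 0 < (t d).2

/-- The binding graph of `α`. Its vertices are the points of `dom α`; it is given as a graph on the
whole lattice, in which the points outside `dom α` are isolated. -/
def bindingGraph {A : Type*} (α : Config A) : SimpleGraph (ℤ × ℤ) where
  Adj p q := ∃ (d : Dir) (t t' : TileType A),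
    q = p + d.vec ∧ α p = some t ∧ α q = some t' ∧ TilesBind t t' d
  symm := ⟨by
    rintro p q ⟨d, t, t', hq, hp, hq', h1, h2⟩
    refine ⟨d.opp, t', t, ?_, hq', hp, ?_, ?_⟩
    · subst hq
      cases d <;> simp [Dir.vec, Dir.opp, add_assoc]
    · cases d <;> exact h1.symm
    · rw [← h1]; exact h2⟩
  loopless := ⟨by
    rintro p ⟨d, t, t', hq, -⟩
    have h := add_eq_left.mp hq.symm
    cases d <;> simp [Dir.vec] at h⟩

/-! ### Finite simple paths, as lists of points; the length of a path is its number of points -/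

/-- `p` is a finite simple path in the full grid graph of the lattice. -/
def IsGridPath (p : List (ℤ × ℤ)) : Prop := p ≠ [] ∧ p.Nodup ∧ p.IsChain gridGraph.Adj

/-- `p` is a finite simple path in the binding graph of `α`. -/
def IsBindingPath {A : Type*} (α : Config A) (p : List (ℤ × ℤ)) : Prop :=
  p ≠ [] ∧ p.Nodup ∧ (∀ v ∈ p, v ∈ dom α) ∧ p.IsChain (bindingGraph α).Adj

/-- The path `p` starts at `a` and ends at `b`. -/
def FromTo (a b : ℤ × ℤ) (p : List (ℤ × ℤ)) : Prop := p.head? = some a ∧ p.getLast? = some b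

/-! ### Stable assemblies, attachment steps, assembly sequences -/

/-- Every cut of the binding graph of `α` has weight at least `1`; since glue strengths are
integers and the edges of the binding graph have positive strength, this means that every cut is
crossed by an edge. -/
def CutCondition {A : Type*} (α : Config A) : Prop :=
  ∀ S : Set (ℤ × ℤ), S ⊆ dom α → S.Nonempty → (dom α \ S).Nonempty →
    ∃ p ∈ S, ∃ q ∈ dom α \ S, (bindingGraph α).Adj p q

/-- `α` is a `1`-stable assembly of tiles from the tile set `T`: non-empty, with tile types in `T`,
and stable. (Stability forces `dom α` to be connected in the grid graph.) -/
def IsStableAssembly {A : Type*} (T : Finset (TileType A)) (α : Config A) : Prop :=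
  (dom α).Nonempty ∧ (∀ p t, α p = some t → t ∈ T) ∧ CutCondition α

/-- `β = α + (p, t)`: the stable assembly `α` produces the stable assembly `β` by attaching one tile
of type `t` at `p`. -/
def Attach {A : Type*} (T : Finset (TileType A)) (α : Config A) (p : ℤ × ℤ) (t : TileType A)
    (β : Config A) : Prop :=
  IsStableAssembly T α ∧ IsStableAssembly T β ∧ Sub α β ∧ dom β \ dom α = {p} ∧ β p = some t

/-- `α` produces `β` in one step. -/
def Step {A : Type*} (T : Finset (TileType A)) (α β : Config A) : Prop := ∃ p t, Attach T α p t β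

/-- A finite or infinite assembly sequence `asm 0, asm 1, …` with `len` terms (indices start at `0`;
only the terms with index below `len` matter). -/
structure AssemblySeq {A : Type*} (T : Finset (TileType A)) where
  len : ℕ∞
  len_pos : 0 < len
  asm : ℕ → Config A
  step : ∀ i : ℕ, ((i + 1 : ℕ) : ℕ∞) < len → Step T (asm i) (asm (i + 1))

/-- `α` is the result of the assembly sequence. -/
def AssemblySeq.HasResult {A : Type*} {T : Finset (TileType A)} (s : AssemblySeq T)
    (α : Config A) : Prop :=
  (dom α = {p | ∃ i : ℕ, (i : ℕ∞) < s.len ∧ p ∈ dom (s.asm i)}) ∧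
    ∀ i : ℕ, (i : ℕ∞) < s.len → Sub (s.asm i) α

/-- The first index at which a tile is present at `p` (meaningful for `p` in the domain of the
result). -/
def AssemblySeq.index {A : Type*} {T : Finset (TileType A)} (s : AssemblySeq T) (p : ℤ × ℤ) : ℕ :=
  sInf {i : ℕ | (i : ℕ∞) < s.len ∧ p ∈ dom (s.asm i)}

/-- The list `l` is a finite assembly sequence that starts with the assembly `σ`. -/
def IsFinSeqFrom {A : Type*} (T : Finset (TileType A)) (σ : Config A) (l : List (Config A)) : Prop :=
  l.head? = some σ ∧ l.IsChain (Step T)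

/-- The finite assembly sequence `l` terminates at `p`: `p` is the point of the last attachment, or
the only point of the first assembly if there is no attachment. -/
def TerminatesAt {A : Type*} (l : List (Config A)) (p : ℤ × ℤ) : Prop :=
  (∃ a, l = [a] ∧ dom a = {p}) ∨ ∃ u a b, l = u ++ [a, b] ∧ dom b \ dom a = {p}

/-! ### Tile assembly systems at temperature `1` -/

/-- A tile assembly system (with temperature `1`): a finite tile set and a seed. -/
structure TAS (A : Type*) where
  tiles : Finset (TileType A)
  seed : Config A

namespace TAS

variable {A : Type*}

/-- The seed of `𝒯` is a single tile of the tile set, placed at `s`. -/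
def SinglySeeded (𝒯 : TAS A) (s : ℤ × ℤ) : Prop :=
  dom 𝒯.seed = {s} ∧ ∀ t, 𝒯.seed s = some t → t ∈ 𝒯.tiles

/-- The producible assemblies: the results of all finite or infinite assembly sequences that start
with the seed. -/
def Producible (𝒯 : TAS A) (α : Config A) : Prop :=
  ∃ s : AssemblySeq 𝒯.tiles, s.asm 0 = 𝒯.seed ∧ s.HasResult α

/-- The producible terminal assemblies. -/
def Terminal (𝒯 : TAS A) (α : Config A) : Prop :=
  𝒯.Producible α ∧ IsStableAssembly 𝒯.tiles α ∧ ¬ ∃ β, Step 𝒯.tiles α β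

/-- `π` and `π'` are competing for `y` from `x` in `𝒯`, where `s` is the point of the seed. -/
structure Competing (𝒯 : TAS A) (s x y : ℤ × ℤ) (π π' : List (ℤ × ℤ)) : Prop where
  ne_points : x ≠ y
  grid : ∀ p ∈ [π, π'], IsGridPath p ∧ FromTo x y p
  ne_paths : π ≠ π'
  inter : {v | v ∈ π} ∩ {v | v ∈ π'} = {x, y}
  exists_path : ∃ p ∈ [π, π'], ∃ α, 𝒯.Producible α ∧ IsBindingPath α p
  /-- Paths of producible assemblies from the seed to a non-final point `v = p[j]` of `p`. -/
  inner : ∀ α, 𝒯.Producible α → ∀ p ∈ [π, π'], ∀ (j : ℕ) (v : ℤ × ℤ), j + 1 < p.length →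
    p[j]? = some v → ∀ p', IsBindingPath α p' → FromTo s v p' →
      (x ∈ p' → p.take (j + 1) <:+ p') ∧
      (x ∉ p' → ∀ q, IsBindingPath α q → FromTo s x q → p' <+: q)
  final : ∀ α, 𝒯.Producible α → ∀ p', IsBindingPath α p' → FromTo s y p' →
    ∃ p ∈ [π, π'], p <:+ p'
  /-- Each of the two paths can self-assemble in isolation from the tile at `x`. -/
  isolated : ∀ α, 𝒯.Producible α → x ∈ dom α → ∀ p ∈ [π, π'], ∃ l β,
    IsFinSeqFrom 𝒯.tiles (single α x) l ∧ l.getLast? = some β ∧ dom β = {v | v ∈ p} ∧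
      IsBindingPath β p
  only_two : ∀ α, 𝒯.Producible α → x ∈ dom α → ∀ l β,
    IsFinSeqFrom 𝒯.tiles (single α x) l → l.getLast? = some β →
      ∀ p, IsBindingPath β p → FromTo x y p → p ∈ [π, π']

/-- The set of points of competition. -/
def POC (𝒯 : TAS A) (s : ℤ × ℤ) : Set (ℤ × ℤ) := {y | ∃ x π π', 𝒯.Competing s x y π π'}

/-- The set of starting points of all points of competition. -/
def Starts (𝒯 : TAS A) (s : ℤ × ℤ) : Set (ℤ × ℤ) := {x | ∃ y π π', 𝒯.Competing s x y π π'}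

/-- `p` is a directionally deterministic point. A vector `u` such that `p` and `p + u` are adjacent
in the binding graph of `α'` is a direction from `p` to a tile to which the tile attached at `p`
binds. -/
def DirDetPoint (𝒯 : TAS A) (s p : ℤ × ℤ) : Prop :=
  p = s ∨ ∀ (α β α' β' : Config A) (tα tβ : TileType A), 𝒯.Producible α → 𝒯.Producible β →
    Attach 𝒯.tiles α p tα α' → Attach 𝒯.tiles β p tβ β' →
      (p ∈ 𝒯.POC s → tα ≠ tβ → ∀ u u' : ℤ × ℤ, (bindingGraph α').Adj p (p + u) →
        (bindingGraph β').Adj p (p + u') → u ≠ u' ∨ α (p + u) ≠ β (p + u')) ∧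
      (p ∉ 𝒯.POC s → tα ≠ tβ → ¬ Agree α β)

/-- Directionally deterministic systems. -/
def DirDet (𝒯 : TAS A) (s : ℤ × ℤ) : Prop :=
  ∀ α, 𝒯.Producible α → ∀ p ∈ dom α, 𝒯.DirDetPoint s p

/-- `α` is a `w`-correct assembly, where `y 0, …, y (r - 1)` are the essential points of competition
and `w i` is the winner at `y i`. -/
def Correct (𝒯 : TAS A) (s : ℤ × ℤ) {r : ℕ} (y : Fin r → ℤ × ℤ) (w : Fin r → TileType A)
    (α : Config A) : Prop :=
  𝒯.Producible α ∧ (∀ i, y i ∈ dom α → α (y i) = some (w i)) ∧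
    dom α ∩ (𝒯.POC s \ Set.range y) = ∅

/-- `𝒯` is singly seeded at `s`, the points `y i` are `r ≥ 1` distinct points of competition, `w` is
a winner function, `α` is the unique `w`-correct terminal assembly whose domain contains all
`y i`, and `𝒯` is `w`-sequentially non-deterministic. -/
structure SeqNonDet (𝒯 : TAS A) (s : ℤ × ℤ) {r : ℕ} (y : Fin r → ℤ × ℤ) (w : Fin r → TileType A)
    (α : Config A) : Prop where
  seeded : 𝒯.SinglySeeded s
  pos : 0 < r
  inj : Function.Injective y
  poc : ∀ i, y i ∈ 𝒯.POC s
  winner : ∀ i, w i ∈ 𝒯.tiles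
  terminal : 𝒯.Terminal α
  correct : 𝒯.Correct s y w α
  covers : ∀ i, y i ∈ dom α
  unique : ∀ β, 𝒯.Terminal β → 𝒯.Correct s y w β → (∀ i, y i ∈ dom β) → β = α
  dirDet : 𝒯.DirDet s
  order : ∀ (q : AssemblySeq 𝒯.tiles) (β : Config A), q.asm 0 = 𝒯.seed → q.HasResult β →
    (∀ i, y i ∈ dom β) → ∀ (i : Fin r) (h : (i : ℕ) + 1 < r), q.index (y i) < q.index (y ⟨i + 1, h⟩)
  starts_disjoint : 𝒯.Starts s ∩ 𝒯.POC s = ∅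

/-! ### Competitions -/

/-- The competition with starting point `x`: the system with the same tile set whose seed is the
tile that `α` places at `x`. -/
def competition (𝒯 : TAS A) (α : Config A) (x : ℤ × ℤ) : TAS A := ⟨𝒯.tiles, single α x⟩

/-- Every simple path in the binding graph of `γ` that starts at `x` is a prefix of `π` or `π'`. -/
def Follows (x : ℤ × ℤ) (π π' : List (ℤ × ℤ)) (γ : Config A) : Prop :=
  ∀ p, IsBindingPath γ p → p.head? = some x → p <+: π ∨ p <+: π'

/-- `γ` is a winning assembly for the competition, with winning path `π` and losing path `π'`. -/
def WinningAssembly (𝒯 : TAS A) (α : Config A) (x : ℤ × ℤ) (π π' : List (ℤ × ℤ))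
    (γ : Config A) : Prop :=
  (𝒯.competition α x).Producible γ ∧ IsBindingPath γ π ∧ Sub γ α ∧ Follows x π π' γ

/-- `π` is the winning path of the competition and `π'` is the losing path. -/
def IsWinningPath (𝒯 : TAS A) (α : Config A) (x : ℤ × ℤ) (π π' : List (ℤ × ℤ)) : Prop :=
  ∃ γ, 𝒯.WinningAssembly α x π π' γ

/-- The competition with starting point `x` and losing path `lose` is rigged in `𝒯`: for every
finite producing sequence that terminates at `x` and whose result `β` is a subassembly of `α`,
there is an inner point of `lose` that lies in `dom β` and on every simple path from `s` to `x` in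
the binding graph of `β`. -/
def Rigged (𝒯 : TAS A) (s : ℤ × ℤ) (α : Config A) (x : ℤ × ℤ) (lose : List (ℤ × ℤ)) : Prop :=
  ∀ l β, IsFinSeqFrom 𝒯.tiles 𝒯.seed l → TerminatesAt l x → l.getLast? = some β → Sub β α →
    ∃ (j : ℕ) (v : ℤ × ℤ), 0 < j ∧ j + 1 < lose.length ∧ lose[j]? = some v ∧ v ∈ dom β ∧
      ∀ p, IsBindingPath β p → FromTo s x p → v ∈ p

end TAS

/-! ### Probabilities -/

/-- The children of the node `l` in the tree with node set `N`, whose nodes are finite sequences and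
in which a child extends its parent by one term. -/
def children {X : Type*} (N : Set (List X)) (l : List X) : Set (List X) :=
  {l' ∈ N | ∃ b, l' = l ++ [b]}

/-- The probability of the node `l` in the tree with node set `N` in which each node passes to each
of its children with equal probability: the product, over the edges from the root (a sequence with
one term) to `l`, of one over the number of children of the parent. -/
def nodeProb {X : Type*} (N : Set (List X)) (l : List X) : ℝ :=
  ∏ k ∈ Finset.Ico 1 l.length, (1 / ((children N (l.take k)).ncard : ℝ))

namespace TAS

variable {A : Type*}

/-- The nodes of the Markov chain of a system: its finite producing assembly sequences. -/
def nodes (𝒯 : TAS A) : Set (List (Config A)) := {l | IsFinSeqFrom 𝒯.tiles 𝒯.seed l}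

/-- The nodes of the chain of the competition that remain after the removal of all sequences whose
result has a simple path from `x` in its binding graph that is not a prefix of `win` or `lose`. -/
def competitionNodes (𝒯 : TAS A) (α : Config A) (x : ℤ × ℤ) (win lose : List (ℤ × ℤ)) :
    Set (List (Config A)) :=
  {l ∈ (𝒯.competition α x).nodes | ∀ γ, l.getLast? = some γ → Follows x win lose γ}

/-- The winning assembly sequences of the competition for `y`. -/
def winningSeqs (𝒯 : TAS A) (α : Config A) (x y : ℤ × ℤ) (win lose : List (ℤ × ℤ)) :
    Set (List (Config A)) :=
  {l ∈ (𝒯.competition α x).nodes | TerminatesAt l y ∧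
    ∃ γ, l.getLast? = some γ ∧ 𝒯.WinningAssembly α x win lose γ}

/-- The probability of the competition for `y` from `x`: the sum of the probabilities of its winning
assembly sequences. -/
def competitionProb (𝒯 : TAS A) (α : Config A) (x y : ℤ × ℤ) (win lose : List (ℤ × ℤ)) : ℝ :=
  ∑' l : 𝒯.winningSeqs α x y win lose, nodeProb (𝒯.competitionNodes α x win lose) l

end TAS

end TileAssembly

end

namespace TileAssembly

variable {A : Type*}

/-! ### Configurations and binding graphs -/

/-! Up to the moment when `y` is filled, a state of the competition is described by how far the two
paths have grown: `merge win lose f g j k` carries `j` tiles of the winning path and `k` of the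
losing path beyond `x`. As long as neither path is complete there are exactly two continuations, so
the chain is a fair coin walk on a grid. It wins if its `(l-1)`-st step along the winning path comes
after `i ≤ l'-2` steps along the losing one. That step is the last; the other `l-2+i` can be ordered
in `(l+i-2).choose (l-2)` ways, each of probability `2^-(l+i-1)`.

The conditions on competing paths and directional determinism speak of assemblies of `𝒯`, not of the
competition. That the competition is not rigged bridges this gap: `exists_base` yields a producible
`β` below `α` that contains `x` and no other point of the two paths. Every state with at most one
complete path can be laid over `β` and is then producible in `𝒯` (`Race.derives_left`). A path of
`β` from the seed to `x`, put in front of a path from `x`, shows that the latter follows one of the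
two paths (`Race.follows`), and directional determinism fixes the tile at each next point
(`Race.attach_eq_merge`). Together they give `Race.step_eq`. The two continuations differ, for
otherwise one assembly would contain both paths, hence a cycle, which `Race.false_of_both` excludes.

It remains to see which sequences win, as a winning assembly must lie below `α`. Terminality fills
the inner points of both paths in `α`, and directional determinism makes the tiles there those of
the states (`Race.merge_sub`). A sequence that reaches `y` along the losing path does not win,
because `α` would then contain both paths. -/

theorem mem_dom {α : Config A} {p : ℤ × ℤ} : p ∈ dom α ↔ ∃ t, α p = some t :=
  Option.ne_none_iff_exists'

theorem Sub.eq {α β : Config A} (h : Sub α β) {p : ℤ × ℤ} (hp : p ∈ dom α) : β p = α p :=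
  (h.2 p hp (h.1 hp)).symm

theorem sub_iff {α β : Config A} : Sub α β ↔ ∀ p ∈ dom α, β p = α p :=
  ⟨fun h _ hp => h.eq hp, fun h =>
    ⟨fun p hp => by show β p ≠ none; rw [h p hp]; exact hp, fun p hp _ => (h p hp).symm⟩⟩

theorem Sub.refl (α : Config A) : Sub α α := sub_iff.2 fun _ _ => rfl

theorem Sub.trans {α β γ : Config A} (h : Sub α β) (h' : Sub β γ) : Sub α γ :=
  sub_iff.2 fun _ hp => (h'.eq (h.1 hp)).trans (h.eq hp)

theorem Sub.agree {α β γ : Config A} (h : Sub α γ) (h' : Sub β γ) : Agree α β :=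
  fun _ hp hp' => (h.eq hp).symm.trans (h'.eq hp')

theorem adj_mem_dom_left {α : Config A} {p q : ℤ × ℤ} (h : (bindingGraph α).Adj p q) :
    p ∈ dom α := by
  obtain ⟨d, t, t', -, hp, -⟩ := h
  exact mem_dom.2 ⟨t, hp⟩

theorem adj_mem_dom_right {α : Config A} {p q : ℤ × ℤ} (h : (bindingGraph α).Adj p q) :
    q ∈ dom α :=
  adj_mem_dom_left h.symm

theorem adj_congr {α β : Config A} {p q : ℤ × ℤ} (h : (bindingGraph α).Adj p q)
    (hp : β p = α p) (hq : β q = α q) : (bindingGraph β).Adj p q := by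
  obtain ⟨d, t, t', h1, h2, h3, h4⟩ := h
  exact ⟨d, t, t', h1, hp.trans h2, hq.trans h3, h4⟩

theorem Sub.adj {α β : Config A} (h : Sub α β) {p q : ℤ × ℤ} (hpq : (bindingGraph α).Adj p q) :
    (bindingGraph β).Adj p q :=
  adj_congr hpq (h.eq (adj_mem_dom_left hpq)) (h.eq (adj_mem_dom_right hpq))

theorem IsBindingPath.mono {α β : Config A} (h : Sub α β) {p : List (ℤ × ℤ)}
    (hp : IsBindingPath α p) : IsBindingPath β p :=
  ⟨hp.1, hp.2.1, fun v hv => h.1 (hp.2.2.1 v hv), hp.2.2.2.imp fun _ _ => h.adj⟩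

theorem isChain_congr {α β : Config A} {p : List (ℤ × ℤ)} (hp : p.IsChain (bindingGraph α).Adj)
    (h : ∀ v ∈ p, β v = α v) : p.IsChain (bindingGraph β).Adj := by
  rw [List.isChain_iff_getElem] at hp ⊢
  intro i hi
  exact adj_congr (hp i hi) (h _ (List.getElem_mem _)) (h _ (List.getElem_mem _))

theorem IsBindingPath.congr {α β : Config A} {p : List (ℤ × ℤ)}
    (hp : IsBindingPath α p) (h : ∀ v ∈ p, β v = α v) : IsBindingPath β p :=
  ⟨hp.1, hp.2.1, fun v hv => by show β v ≠ none; rw [h v hv]; exact hp.2.2.1 v hv,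
    isChain_congr hp.2.2.2 h⟩

theorem IsBindingPath.infix {α : Config A} {p q : List (ℤ × ℤ)}
    (hp : IsBindingPath α p) (hq : q ≠ []) (h : q <:+: p) : IsBindingPath α q :=
  ⟨hq, hp.2.1.sublist h.sublist, fun v hv => hp.2.2.1 v (h.subset hv), hp.2.2.2.infix h⟩

theorem IsBindingPath.append {α : Config A} {q p : List (ℤ × ℤ)} {x : ℤ × ℤ}
    (hq : IsBindingPath α (q ++ [x])) (hp : IsBindingPath α (x :: p))
    (hd : ∀ v ∈ p, v ∉ q ++ [x]) : IsBindingPath α (q ++ x :: p) := by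
  have e : q ++ x :: p = (q ++ [x]) ++ p := by simp
  refine ⟨by simp, ?_, ?_, ?_⟩
  · rw [e]
    refine List.Nodup.append hq.2.1 hp.2.1.of_cons ?_
    intro v hv hv'
    exact hd v hv' hv
  · intro v hv
    rcases List.mem_append.1 hv with h | h
    · exact hq.2.2.1 v (by simp [h])
    · exact hp.2.2.1 v h
  · rw [e]
    exact List.IsChain.append_overlap hq.2.2.2 (by simpa using hp.2.2.2) (by simp)

theorem reachable_of_chain {G : SimpleGraph (ℤ × ℤ)} {a : ℤ × ℤ} {p : List (ℤ × ℤ)}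
    (h : (a :: p).IsChain G.Adj) : ∀ b ∈ a :: p, G.Reachable a b := by
  induction p generalizing a with
  | nil => intro b hb; simp at hb; subst hb; rfl
  | cons c p ih =>
    intro b hb
    rw [List.isChain_cons_cons] at h
    rcases List.mem_cons.1 hb with rfl | hb
    · rfl
    · exact h.1.reachable.trans (ih h.2 b hb)

theorem IsBindingPath.reachable {α : Config A} {a b : ℤ × ℤ} {p : List (ℤ × ℤ)}
    (hp : IsBindingPath α p) (h : FromTo a b p) : (bindingGraph α).Reachable a b := by
  obtain ⟨h1, h2⟩ := h
  cases p with
  | nil => simp at h1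
  | cons c p =>
    simp only [List.head?_cons, Option.some.injEq] at h1
    subst h1
    exact reachable_of_chain hp.2.2.2 b (List.mem_of_getLast? h2)

theorem exists_path_of_reachable {α : Config A} {a b : ℤ × ℤ}
    (h : (bindingGraph α).Reachable a b) (ha : a ∈ dom α) :
    ∃ p, IsBindingPath α p ∧ FromTo a b p := by
  classical
  obtain ⟨w, hw⟩ := h.exists_isPath
  refine ⟨w.support, ⟨w.support_ne_nil, hw.support_nodup, ?_, w.isChain_adj_support⟩, ?_, ?_⟩
  · clear hw
    induction w with
    | nil => simpa using ha
    | cons hadj w ih =>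
      intro v hv
      rw [SimpleGraph.Walk.support_cons, List.mem_cons] at hv
      rcases hv with rfl | hv
      · exact ha
      · exact ih ⟨w⟩ (adj_mem_dom_right hadj) v hv
  · rw [List.head?_eq_some_head w.support_ne_nil, w.head_support]
  · rw [List.getLast?_eq_some_getLast w.support_ne_nil, w.getLast_support]

/-- Otherwise the points reachable from `a` would form a cut crossed by no edge. -/
theorem CutCondition.reachable {α : Config A} (h : CutCondition α) {a b : ℤ × ℤ}
    (ha : a ∈ dom α) (hb : b ∈ dom α) : (bindingGraph α).Reachable a b := by
  by_contra hn
  obtain ⟨p, hp, q, hq, hpq⟩ := h {v | v ∈ dom α ∧ (bindingGraph α).Reachable a v}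
    (fun v hv => hv.1) ⟨a, ha, SimpleGraph.Reachable.refl a⟩ ⟨b, hb, fun h => hn h.2⟩
  exact hq.2 ⟨hq.1, hp.2.trans hpq.reachable⟩

theorem IsStableAssembly.exists_path {T : Finset (TileType A)} {α : Config A}
    (h : IsStableAssembly T α) {a b : ℤ × ℤ} (ha : a ∈ dom α) (hb : b ∈ dom α) :
    ∃ p, IsBindingPath α p ∧ FromTo a b p :=
  exists_path_of_reachable (h.2.2.reachable ha hb) ha

/-! ### Attachments -/

theorem isStableAssembly_of_dom_eq_singleton {T : Finset (TileType A)} {α : Config A} {x : ℤ × ℤ}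
    (hd : dom α = {x}) (hT : ∀ t, α x = some t → t ∈ T) : IsStableAssembly T α := by
  refine ⟨by simp [hd], fun p t hp => ?_, fun S hS hS1 hS2 => ?_⟩
  · have : p ∈ dom α := mem_dom.2 ⟨t, hp⟩
    rw [hd] at this
    obtain rfl : p = x := this
    exact hT t hp
  · obtain ⟨a, ha⟩ := hS1
    obtain ⟨b, hb, hb'⟩ := hS2
    have h1 := hS ha
    rw [hd] at h1 hb
    exact absurd ((h1.trans hb.symm : a = b) ▸ ha) hb'

theorem dom_update {α : Config A} {p : ℤ × ℤ} {t : TileType A} :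
    dom (Function.update α p (some t)) = insert p (dom α) := by
  ext v
  by_cases h : v = p <;> simp [dom, Function.update_apply, h]

theorem sub_update {α : Config A} {p : ℤ × ℤ} {o : Option (TileType A)} (hp : p ∉ dom α) :
    Sub α (Function.update α p o) :=
  sub_iff.2 fun v hv => Function.update_of_ne (by rintro rfl; exact hp hv) _ _


/-- A cut that splits `dom α` is crossed by stability of `α`; any other cut separates `p` from all
of `dom α`, and the bond to `q` crosses it. -/
theorem attach_update {T : Finset (TileType A)} {α : Config A} {p q : ℤ × ℤ} {t : TileType A}
    (h : IsStableAssembly T α) (hp : p ∉ dom α) (ht : t ∈ T)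
    (hq : (bindingGraph (Function.update α p (some t))).Adj p q) :
    Attach T α p t (Function.update α p (some t)) := by
  have hsub := sub_update (o := some t) hp
  have hqα : q ∈ dom α := by
    have := adj_mem_dom_right hq
    rw [dom_update] at this
    exact this.resolve_left hq.ne'
  refine ⟨h, ⟨h.1.mono hsub.1, ?_, ?_⟩, hsub, ?_, by simp⟩
  · intro v t' hv
    by_cases hvp : v = p
    · subst hvp; simp at hv; exact hv ▸ ht
    · rw [Function.update_of_ne hvp] at hv; exact h.2.1 v t' hv
  · intro S hS hS1 hS2
    by_cases h1 : (S ∩ dom α).Nonempty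
    · by_cases h2 : (dom α \ S).Nonempty
      · obtain ⟨a, ha, b, hb, hab⟩ := h.2.2 (S ∩ dom α) Set.inter_subset_right h1
          (by obtain ⟨b, hb, hb'⟩ := h2; exact ⟨b, hb, fun h => hb' h.1⟩)
        exact ⟨a, ha.1, b, ⟨hsub.1 hb.1, fun hbS => hb.2 ⟨hbS, hb.1⟩⟩, hsub.adj hab⟩
      · have hall : ∀ v ∈ dom α, v ∈ S := fun v hv => by
          by_contra hn; exact h2 ⟨v, hv, hn⟩
        obtain ⟨b, hb, hb'⟩ := hS2
        rw [dom_update] at hb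
        obtain rfl : b = p := hb.resolve_right fun h => hb' (hall b h)
        exact ⟨q, hall q hqα, b, ⟨by simp [dom_update], hb'⟩, hq.symm⟩
    · have hno : ∀ v ∈ S, v ∉ dom α := fun v hv hv' => h1 ⟨v, hv, hv'⟩
      obtain ⟨a, ha⟩ := hS1
      have := hS ha
      rw [dom_update] at this
      obtain rfl : a = p := this.resolve_right (hno a ha)
      exact ⟨a, ha, q, ⟨hsub.1 hqα, fun h => hno q h hqα⟩, hq⟩
  · rw [dom_update]
    ext v
    simp only [Set.mem_sdiff, Set.mem_insert_iff, Set.mem_singleton_iff]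
    exact ⟨fun h => h.1.resolve_right h.2, by rintro rfl; exact ⟨Or.inl rfl, hp⟩⟩

theorem Attach.notMem {T : Finset (TileType A)} {α β : Config A} {p : ℤ × ℤ} {t : TileType A}
    (h : Attach T α p t β) : p ∉ dom α := by
  have : p ∈ dom β \ dom α := by rw [h.2.2.2.1]; rfl
  exact this.2

theorem Attach.eq_update {T : Finset (TileType A)} {α β : Config A} {p : ℤ × ℤ} {t : TileType A}
    (h : Attach T α p t β) : β = Function.update α p (some t) := by
  funext v
  by_cases hv : v = p
  · subst hv; simpa using h.2.2.2.2
  · rw [Function.update_of_ne hv]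
    by_cases hα : v ∈ dom α
    · exact h.2.2.1.eq hα
    · have hβ : v ∉ dom β := fun hβ => hv (by
        have : v ∈ dom β \ dom α := ⟨hβ, hα⟩
        rw [h.2.2.2.1] at this; exact this)
      rw [not_not.1 hα, not_not.1 hβ]

theorem Attach.mem_tiles {T : Finset (TileType A)} {α β : Config A} {p : ℤ × ℤ} {t : TileType A}
    (h : Attach T α p t β) : t ∈ T := h.2.1.2.1 p t h.2.2.2.2

theorem Attach.exists_adj {T : Finset (TileType A)} {α β : Config A} {p : ℤ × ℤ} {t : TileType A}
    (h : Attach T α p t β) : ∃ q ∈ dom α, (bindingGraph β).Adj p q := by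
  have hp : p ∈ dom β := mem_dom.2 ⟨t, h.2.2.2.2⟩
  obtain ⟨v, hv⟩ := h.1.1
  obtain ⟨a, ha, q, hq, haq⟩ := h.2.1.2.2 {p} (by simpa using hp) (by simp)
    ⟨v, h.2.2.1.1 hv, fun e => h.notMem ((e : v = p) ▸ hv)⟩
  obtain rfl : a = p := ha
  refine ⟨q, ?_, haq⟩
  by_contra hn
  have : q ∈ dom β \ dom α := ⟨hq.1, hn⟩
  rw [h.2.2.2.1] at this
  exact hq.2 this

/-! ### Finite derivations -/

/-- `β` is obtained from `α` by finitely many attachments. -/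
abbrev Derives (T : Finset (TileType A)) (α β : Config A) : Prop :=
  Relation.ReflTransGen (Step T) α β

theorem Step.sub {T : Finset (TileType A)} {α β : Config A} (h : Step T α β) : Sub α β := by
  obtain ⟨p, t, h⟩ := h
  exact h.2.2.1

theorem Step.stable {T : Finset (TileType A)} {α β : Config A} (h : Step T α β) :
    IsStableAssembly T β := by
  obtain ⟨p, t, h⟩ := h
  exact h.2.1

theorem Derives.sub {T : Finset (TileType A)} {α β : Config A} (h : Derives T α β) : Sub α β := by
  induction h with
  | refl => exact Sub.refl _
  | tail _ h ih => exact ih.trans h.sub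

theorem Derives.stable {T : Finset (TileType A)} {α β : Config A} (h : Derives T α β)
    (hα : IsStableAssembly T α) : IsStableAssembly T β := by
  cases h with
  | refl => exact hα
  | tail _ h => exact h.stable

theorem isFinSeqFrom_append_pair {T : Finset (TileType A)} {σ a b : Config A}
    {l : List (Config A)} :
    IsFinSeqFrom T σ (l ++ [a] ++ [b]) ↔ IsFinSeqFrom T σ (l ++ [a]) ∧ Step T a b := by
  unfold IsFinSeqFrom
  rw [List.isChain_append, List.head?_append_of_ne_nil _ (by simp)]
  simp [and_assoc]

theorem IsFinSeqFrom.derives {T : Finset (TileType A)} {σ β : Config A} {l : List (Config A)}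
    (h : IsFinSeqFrom T σ l) (hβ : l.getLast? = some β) : Derives T σ β := by
  induction l using List.reverseRecOn generalizing β with
  | nil => simp at hβ
  | append_singleton l b ih =>
    simp only [List.getLast?_append, List.getLast?_singleton, Option.some_or,
      Option.some.injEq] at hβ
    subst hβ
    rcases l.eq_nil_or_concat with rfl | ⟨l, a, rfl⟩
    · have := h.1; simp at this; subst this; exact .refl
    · rw [List.concat_eq_append] at *
      rw [isFinSeqFrom_append_pair] at h
      exact .tail (ih h.1 (by simp)) h.2

theorem Derives.exists_chain {T : Finset (TileType A)} {σ β : Config A} (h : Derives T σ β) :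
    ∃ (n : ℕ) (a : ℕ → Config A), a 0 = σ ∧ a n = β ∧ ∀ i < n, Step T (a i) (a (i + 1)) := by
  induction h with
  | refl => exact ⟨0, fun _ => σ, rfl, rfl, by simp⟩
  | @tail b c _ h ih =>
    obtain ⟨n, a, h0, hn, hs⟩ := ih
    refine ⟨n + 1, fun i => if i ≤ n then a i else c, by simpa, by simp, fun i hi => ?_⟩
    have hi' : i ≤ n := by omega
    by_cases h1 : i + 1 ≤ n
    · simpa [hi', h1] using hs i (by omega)
    · obtain rfl : i = n := by omega
      simpa [hn] using h

theorem chain_sub {T : Finset (TileType A)} {a : ℕ → Config A} {n : ℕ}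
    (h : ∀ i < n, Step T (a i) (a (i + 1))) {i j : ℕ} (hij : i ≤ j) (hj : j ≤ n) :
    Sub (a i) (a j) := by
  induction j, hij using Nat.le_induction with
  | base => exact Sub.refl _
  | succ j _ ih => exact (ih (by omega)).trans (h j (by omega)).sub

theorem Derives.producible {𝒯 : TAS A} {β : Config A} (h : Derives 𝒯.tiles 𝒯.seed β) :
    𝒯.Producible β := by
  obtain ⟨n, a, h0, rfl, hs⟩ := h.exists_chain
  have key : ∀ i : ℕ, (i : ℕ∞) < ((n + 1 : ℕ) : ℕ∞) ↔ i ≤ n := fun i => by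
    rw [Nat.cast_lt]; omega
  refine ⟨⟨((n + 1 : ℕ) : ℕ∞), by simp, a, fun i hi => hs i ?_⟩, h0, ?_, ?_⟩
  · rw [key] at hi; omega
  · ext p
    simp only [Set.mem_ofPred_eq, key]
    exact ⟨fun h => ⟨n, le_rfl, h⟩, fun ⟨i, hi, h⟩ => (chain_sub hs hi le_rfl).1 h⟩
  · intro i hi
    exact chain_sub hs ((key i).1 hi) le_rfl

/-- A point of a producible assembly outside the seed receives its tile at some attachment. -/
theorem TAS.Producible.exists_attach {𝒯 : TAS A} {α : Config A} (h : 𝒯.Producible α) {p : ℤ × ℤ}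
    (hp : p ∈ dom α) (hs : p ∉ dom 𝒯.seed) :
    ∃ a b t, Derives 𝒯.tiles 𝒯.seed a ∧ Attach 𝒯.tiles a p t b ∧ Sub b α := by
  classical
  obtain ⟨q, h0, hd, hsub⟩ := h
  rw [hd] at hp
  have hder : ∀ i : ℕ, (i : ℕ∞) < q.len → Derives 𝒯.tiles 𝒯.seed (q.asm i) := by
    intro i
    induction i with
    | zero => intro _; rw [h0]
    | succ i ih =>
      intro hi
      exact .tail (ih (lt_of_le_of_lt (by exact_mod_cast Nat.le_succ i) hi)) (q.step i hi)
  -- The first index at which `p` is occupied; it is positive because `p` lies outside the seed.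
  have hn := Nat.find_spec hp
  have hmin := fun m => @Nat.find_min _ _ hp m
  generalize Nat.find hp = n at hn hmin
  cases n with
  | zero => rw [h0] at hn; exact absurd hn.2 hs
  | succ n =>
    have hlt : (n : ℕ∞) < q.len := lt_of_le_of_lt (by exact_mod_cast Nat.le_succ n) hn.1
    obtain ⟨p', t, hat⟩ := q.step n hn.1
    have hpn : p ∉ dom (q.asm n) := fun hp => hmin n (Nat.lt_succ_self n) ⟨hlt, hp⟩
    have : p ∈ dom (q.asm (n + 1)) \ dom (q.asm n) := ⟨hn.2, hpn⟩
    rw [hat.2.2.2.1] at this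
    obtain rfl : p = p' := this
    exact ⟨_, _, t, hder n hlt, hat, hsub _ hn.1⟩

theorem TAS.SinglySeeded.stable {𝒯 : TAS A} {s : ℤ × ℤ} (h : 𝒯.SinglySeeded s) :
    IsStableAssembly 𝒯.tiles 𝒯.seed :=
  isStableAssembly_of_dom_eq_singleton h.1 h.2

theorem TAS.SinglySeeded.mem {𝒯 : TAS A} {s : ℤ × ℤ} (h : 𝒯.SinglySeeded s) : s ∈ dom 𝒯.seed := by
  rw [h.1]; rfl

/-! ### Two arms growing from a common point -/

theorem getElem_mem_take_iff {X : Type*} {l : List X} (h : l.Nodup) {m n : ℕ} (hm : m < l.length) :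
    l[m] ∈ l.take n ↔ m < n := by
  rw [List.mem_take_iff_getElem]
  constructor
  · rintro ⟨i, hi, he⟩
    have := (h.getElem_inj_iff).1 he
    omega
  · intro hmn
    exact ⟨m, by omega, rfl⟩

/-- The points of `P.take (j + 1)` with the tiles of `f`, and those of `Q.take (k + 1)` with the
tiles of `g`. -/
def merge (P Q : List (ℤ × ℤ)) (f g : Config A) (j k : ℕ) : Config A := fun v =>
  if v ∈ P.take (j + 1) then f v else if v ∈ Q.take (k + 1) then g v else none

/-- The union of `γ` and `β`, where `γ` takes precedence. -/
def overlay (γ β : Config A) : Config A := fun v => (γ v).or (β v)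

theorem overlay_of_mem {γ β : Config A} {v : ℤ × ℤ} (h : v ∈ dom γ) : overlay γ β v = γ v := by
  obtain ⟨t, ht⟩ := mem_dom.1 h
  simp [overlay, ht]

theorem overlay_of_notMem {γ β : Config A} {v : ℤ × ℤ} (h : v ∉ dom γ) :
    overlay γ β v = β v := by
  simp [overlay, not_not.1 h]

theorem dom_overlay {γ β : Config A} : dom (overlay γ β) = dom γ ∪ dom β := by
  ext v
  by_cases h : v ∈ dom γ
  · exact ⟨fun _ => .inl h, fun _ => by show overlay γ β v ≠ none; rw [overlay_of_mem h]; exact h⟩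
  · show overlay γ β v ≠ none ↔ _
    rw [overlay_of_notMem h]
    exact ⟨.inr, fun h' => h'.resolve_left h⟩

theorem sub_overlay_left {γ β : Config A} : Sub γ (overlay γ β) :=
  sub_iff.2 fun _ => overlay_of_mem

theorem sub_overlay_right {γ β : Config A} (h : Agree γ β) : Sub β (overlay γ β) :=
  sub_iff.2 fun v hv => by
    by_cases hγ : v ∈ dom γ
    · rw [overlay_of_mem hγ, h v hγ hv]
    · exact overlay_of_notMem hγ

theorem overlay_sub {γ β δ : Config A} (h : Sub γ δ) (h' : Sub β δ) : Sub (overlay γ β) δ :=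
  sub_iff.2 fun v hv => by
    by_cases hγ : v ∈ dom γ
    · rw [overlay_of_mem hγ, h.eq hγ]
    · rw [overlay_of_notMem hγ]
      rw [dom_overlay] at hv
      exact h'.eq (hv.resolve_left hγ)

theorem overlay_update {γ β : Config A} {p : ℤ × ℤ} {t : TileType A} :
    overlay (Function.update γ p (some t)) β = Function.update (overlay γ β) p (some t) := by
  funext v
  by_cases h : v = p <;> simp [overlay, h]

/-- Two paths `P` and `Q` from `x` to `y` that meet only at their ends, together with configurations
`f` and `g` on them in which they are binding paths. -/
structure Arms (T : Finset (TileType A)) (x y : ℤ × ℤ) (P Q : List (ℤ × ℤ)) (f g : Config A) :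
    Prop where
  ne : x ≠ y
  pathL : IsBindingPath f P
  pathR : IsBindingPath g Q
  endsL : FromTo x y P
  endsR : FromTo x y Q
  meet : ∀ v, v ∈ P → v ∈ Q → v = x ∨ v = y
  tilesL : ∀ v t, f v = some t → t ∈ T
  tilesR : ∀ v t, g v = some t → t ∈ T
  start : f x = g x

namespace Arms

variable {T : Finset (TileType A)} {x y : ℤ × ℤ} {P Q : List (ℤ × ℤ)} {f g : Config A}

theorem swap (h : Arms T x y P Q f g) : Arms T x y Q P g f :=
  ⟨h.ne, h.pathR, h.pathL, h.endsR, h.endsL, fun v h1 h2 => h.meet v h2 h1, h.tilesR, h.tilesL,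
    h.start.symm⟩

theorem _root_.TileAssembly.FromTo.two_le {x y : ℤ × ℤ} {P : List (ℤ × ℤ)} (h : FromTo x y P)
    (hne : x ≠ y) : 2 ≤ P.length := by
  obtain ⟨h1, h2⟩ := h
  match P with
  | [] => simp at h1
  | [a] => simp at h1 h2; exact absurd (h1.symm.trans h2) hne
  | _ :: _ :: _ => simp

theorem _root_.TileAssembly.FromTo.getElem_zero {x y : ℤ × ℤ} {P : List (ℤ × ℤ)}
    (h : FromTo x y P) (h0 : 0 < P.length) : P[0] = x := by
  have := h.1
  rw [List.head?_eq_getElem?, List.getElem?_eq_getElem h0] at this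
  exact Option.some.inj this

theorem _root_.TileAssembly.FromTo.getElem_last {x y : ℤ × ℤ} {P : List (ℤ × ℤ)}
    (h : FromTo x y P) {n : ℕ} (hn : n + 1 = P.length) : P[n] = y := by
  have := h.2
  rw [List.getLast?_eq_getElem?, ← hn] at this
  simp only [Nat.add_sub_cancel] at this
  rw [List.getElem?_eq_getElem (by omega)] at this
  exact Option.some.inj this

theorem _root_.TileAssembly.FromTo.take_one {x y : ℤ × ℤ} {P : List (ℤ × ℤ)} (h : FromTo x y P) :
    P.take 1 = [x] := by
  obtain ⟨h1, -⟩ := h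
  cases P <;> simp_all

theorem lenL (h : Arms T x y P Q f g) : 2 ≤ P.length := h.endsL.two_le h.ne

theorem start_mem_take (h : Arms T x y P Q f g) (j : ℕ) : x ∈ P.take (j + 1) := by
  have h0 : 0 < P.length := by have := h.lenL; omega
  rw [← h.endsL.getElem_zero h0, getElem_mem_take_iff h.pathL.2.1]
  omega

theorem end_mem_take (h : Arms T x y P Q f g) (j : ℕ) : y ∈ P.take (j + 1) ↔ P.length ≤ j + 1 := by
  have h0 := h.lenL
  rw [← h.endsL.getElem_last (n := P.length - 1) (by omega), getElem_mem_take_iff h.pathL.2.1]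
  omega

/-- The precedence of `f` matters only where both arms are present: at `x`, where the tiles
coincide, and at `y`, which by `hjk` is not reached by both. The tiles `f y` and `g y` may differ.
This symmetry lets most arguments treat the left arm only. -/
theorem merge_swap (h : Arms T x y P Q f g) {j k : ℕ} (hjk : j + 1 < P.length ∨ k + 1 < Q.length) :
    merge P Q f g j k = merge Q P g f k j := by
  funext v
  unfold merge
  by_cases h1 : v ∈ P.take (j + 1) <;> by_cases h2 : v ∈ Q.take (k + 1) <;>
    simp only [h1, h2, if_true, if_false]
  rcases h.meet v (List.mem_of_mem_take h1) (List.mem_of_mem_take h2) with rfl | rfl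
  · exact h.start
  · rw [h.end_mem_take] at h1
    rw [h.swap.end_mem_take] at h2
    omega

theorem merge_left {j k : ℕ} {v : ℤ × ℤ} (hv : v ∈ P.take (j + 1)) :
    merge P Q f g j k v = f v := by simp [merge, hv]

theorem merge_right (h : Arms T x y P Q f g) {j k : ℕ} {v : ℤ × ℤ}
    (hjk : j + 1 < P.length ∨ k + 1 < Q.length) (hv : v ∈ Q.take (k + 1)) :
    merge P Q f g j k v = g v := by
  rw [h.merge_swap hjk, merge_left hv]

theorem dom_merge (h : Arms T x y P Q f g) (j k : ℕ) :
    dom (merge P Q f g j k) = {v | v ∈ P.take (j + 1) ∨ v ∈ Q.take (k + 1)} := by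
  ext v
  show merge P Q f g j k v ≠ none ↔ v ∈ P.take (j + 1) ∨ v ∈ Q.take (k + 1)
  unfold merge
  by_cases h1 : v ∈ P.take (j + 1)
  · simp only [h1, if_true, true_or, iff_true]
    exact h.pathL.2.2.1 v (List.mem_of_mem_take h1)
  · by_cases h2 : v ∈ Q.take (k + 1)
    · simp only [h1, h2, if_true, or_true, iff_true]
      exact h.pathR.2.2.1 v (List.mem_of_mem_take h2)
    · simp [h1, h2]

theorem mem_of_mem_dom_merge (h : Arms T x y P Q f g) {j k : ℕ} {v : ℤ × ℤ}
    (hv : v ∈ dom (merge P Q f g j k)) : v ∈ P ∨ v ∈ Q := by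
  rw [h.dom_merge] at hv
  exact hv.imp List.mem_of_mem_take List.mem_of_mem_take

theorem merge_succ (h : Arms T x y P Q f g) {j k : ℕ} (hj : j + 1 < P.length) :
    merge P Q f g (j + 1) k = Function.update (merge P Q f g j k) P[j + 1] (f P[j + 1]) := by
  funext v
  have e : P.take (j + 1 + 1) = P.take (j + 1) ++ [P[j + 1]] := (List.take_append_getElem hj).symm
  by_cases hv : v = P[j + 1]
  · subst hv
    rw [Function.update_self, merge_left]
    rw [getElem_mem_take_iff h.pathL.2.1]; omega
  · rw [Function.update_of_ne hv]
    have : v ∈ P.take (j + 1 + 1) ↔ v ∈ P.take (j + 1) := by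
      rw [e, List.mem_append, List.mem_singleton]; tauto
    simp only [merge, this]

theorem next_ne_start (h : Arms T x y P Q f g) {j : ℕ} (hj : j + 1 < P.length) : P[j + 1] ≠ x := by
  intro e
  have h0 : 0 < P.length := by omega
  rw [← h.endsL.getElem_zero h0, h.pathL.2.1.getElem_inj_iff] at e
  omega

theorem next_notMem (h : Arms T x y P Q f g) {j k : ℕ} (hj : j + 1 < P.length)
    (hk : k + 1 < Q.length) : P[j + 1] ∉ dom (merge P Q f g j k) := by
  rw [h.dom_merge]
  rintro (h1 | h1)
  · rw [getElem_mem_take_iff h.pathL.2.1] at h1; omega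
  · rcases h.meet _ (List.getElem_mem hj) (List.mem_of_mem_take h1) with e | e
    · exact h.next_ne_start hj e
    · rw [e, h.swap.end_mem_take] at h1; omega

/-- A stable assembly on top of which the two arms can grow. -/
structure Base (T : Finset (TileType A)) (x : ℤ × ℤ) (P Q : List (ℤ × ℤ)) (f B : Config A) :
    Prop where
  stable : IsStableAssembly T B
  start : B x = f x
  inter : ∀ v, v ∈ P ∨ v ∈ Q → v ∈ dom B → v = x

theorem Base.swap {B : Config A} (hB : Base T x P Q f B) (h : Arms T x y P Q f g) :
    Base T x Q P g B :=
  ⟨hB.stable, hB.start.trans h.start, fun v hv => hB.inter v hv.symm⟩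

theorem agree_base (h : Arms T x y P Q f g) {B : Config A} (hB : Base T x P Q f B) {j k : ℕ} :
    Agree (merge P Q f g j k) B := by
  intro v hv hv'
  obtain rfl := hB.inter v (h.mem_of_mem_dom_merge hv) hv'
  rw [merge_left (h.start_mem_take j), hB.start]

theorem attach_merge (h : Arms T x y P Q f g) {B : Config A} (hB : Base T x P Q f B) {j k : ℕ}
    (hj : j + 1 < P.length) (hk : k + 1 < Q.length)
    (hst : IsStableAssembly T (overlay (merge P Q f g j k) B)) :
    ∃ t, f P[j + 1] = some t ∧
      Attach T (overlay (merge P Q f g j k) B) P[j + 1] t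
        (overlay (merge P Q f g (j + 1) k) B) := by
  obtain ⟨t, ht⟩ := mem_dom.1 (h.pathL.2.2.1 _ (List.getElem_mem hj))
  refine ⟨t, ht, ?_⟩
  have hadj := (List.isChain_iff_getElem.1 h.pathL.2.2.2 j hj).symm
  have hm : ∀ m, m ≤ j + 1 → (hm : m < P.length) → P[m] ∈ dom (merge P Q f g (j + 1) k) ∧
      merge P Q f g (j + 1) k P[m] = f P[m] := fun m hmj hm => by
    have : P[m] ∈ P.take (j + 1 + 1) := by rw [getElem_mem_take_iff h.pathL.2.1]; omega
    exact ⟨by rw [h.dom_merge]; exact .inl this, merge_left this⟩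
  have h1 := hm (j + 1) le_rfl hj
  have h2 := hm j (by omega) (by omega)
  have hadj' : (bindingGraph (overlay (merge P Q f g (j + 1) k) B)).Adj P[j + 1] P[j] :=
    adj_congr hadj (by rw [overlay_of_mem h1.1, h1.2]) (by rw [overlay_of_mem h2.1, h2.2])
  rw [h.merge_succ hj, ht, overlay_update] at hadj' ⊢
  refine attach_update hst ?_ (h.tilesL _ _ ht) hadj'
  rw [dom_overlay]
  rintro (h3 | h3)
  · exact h.next_notMem hj hk h3
  · exact h.next_ne_start hj (hB.inter _ (.inl (List.getElem_mem hj)) h3)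

theorem overlay_zero (h : Arms T x y P Q f g) {B : Config A} (hB : Base T x P Q f B) :
    overlay (merge P Q f g 0 0) B = B := by
  funext v
  by_cases hv : v ∈ dom (merge P Q f g 0 0)
  · rw [overlay_of_mem hv]
    have hx : v = x := by
      rw [h.dom_merge, h.endsL.take_one, h.endsR.take_one] at hv
      simpa using hv
    rw [hx, merge_left (h.start_mem_take 0), hB.start]
  · exact overlay_of_notMem hv

/-- The right arm grows first, then the left one; only the left arm may reach `y`, so each new point
is vacant. With `B = β` this makes states producible in `𝒯`, with `B = single α x` in the
competition. -/
theorem derives_left (h : Arms T x y P Q f g) {B : Config A} (hB : Base T x P Q f B) {j k : ℕ}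
    (hj : j < P.length) (hk : k + 1 < Q.length) :
    Derives T B (overlay (merge P Q f g j k) B) := by
  induction j with
  | zero =>
    induction k with
    | zero => rw [h.overlay_zero hB]
    | succ k ih =>
      have := ih (by omega)
      have hP := h.lenL
      rw [h.merge_swap (.inr (by omega))] at this ⊢
      obtain ⟨t, -, ht⟩ := h.swap.attach_merge (hB.swap h) (j := k) (k := 0) (by omega) (by omega)
        (this.stable hB.stable)
      exact .tail this ⟨_, _, ht⟩
  | succ j ih =>
    have := ih (by omega)
    obtain ⟨t, -, ht⟩ := h.attach_merge hB hj hk (this.stable hB.stable)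
    exact .tail this ⟨_, _, ht⟩

/-- The left arm is a binding path as soon as it is complete. -/
theorem isBindingPath_left (h : Arms T x y P Q f g) {j k : ℕ} (hj : j + 1 = P.length) :
    IsBindingPath (merge P Q f g j k) P :=
  h.pathL.congr fun v hv => merge_left (by rwa [List.take_of_length_le hj.ge])

theorem isBindingPath_right (h : Arms T x y P Q f g) {j k : ℕ} (hj : j + 1 < P.length)
    (hk : k + 1 = Q.length) : IsBindingPath (merge P Q f g j k) Q := by
  rw [h.merge_swap (.inl hj)]
  exact h.swap.isBindingPath_left hk

end Arms

/-! ### Competing paths above an assembly of the whole system -/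

theorem TAS.Competing.swap {𝒯 : TAS A} {s x y : ℤ × ℤ} {P Q : List (ℤ × ℤ)}
    (h : 𝒯.Competing s x y P Q) : 𝒯.Competing s x y Q P := by
  have e : ∀ p, p ∈ [Q, P] ↔ p ∈ [P, Q] := fun p => by simp [or_comm]
  refine ⟨h.ne_points, fun p hp => h.grid p ((e p).1 hp), h.ne_paths.symm, ?_, ?_, ?_, ?_, ?_, ?_⟩
  · rw [Set.inter_comm]; exact h.inter
  · simp only [e]; exact h.exists_path
  · exact fun α hα p hp => h.inner α hα p ((e p).1 hp)
  · simp only [e]; exact h.final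
  · exact fun α hα hx p hp => h.isolated α hα hx p ((e p).1 hp)
  · simp only [e]; exact h.only_two

/-- Without repetitions `x` marks the same position in both lists. This turns the suffix conditions
on competing paths into equalities of the parts after `x`. -/
theorem eq_of_cons_isSuffix {X : Type*} {x : X} {q p r : List X} (hn : (q ++ x :: p).Nodup)
    (h : x :: r <:+ q ++ x :: p) : r = p := by
  obtain ⟨t, ht⟩ := h
  rw [← ht] at hn
  have h1 : x ∉ t ∧ x ∉ r := by
    rw [List.nodup_append] at hn
    exact ⟨fun hx => hn.2.2 x hx x (by simp) rfl, (List.nodup_cons.1 hn.2.1).1⟩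
  rw [ht] at hn
  have h2 : x ∉ q ∧ x ∉ p := by
    rw [List.nodup_append] at hn
    exact ⟨fun hx => hn.2.2 x hx x (by simp) rfl, (List.nodup_cons.1 hn.2.1).1⟩
  exact ((List.append_cons_inj_of_notMem h1.1 h1.2).1 ht).2.2

/-- Two competing paths, together with configurations `f` and `g` on them, and an assembly `β`
produced by `𝒯` on top of which both of them can grow. -/
structure Race (𝒯 : TAS A) (s x y : ℤ × ℤ) (P Q : List (ℤ × ℤ)) (f g β : Config A) : Prop where
  comp : 𝒯.Competing s x y P Q
  dirDet : 𝒯.DirDet s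
  seeded : 𝒯.SinglySeeded s
  derives : Derives 𝒯.tiles 𝒯.seed β
  arms : Arms 𝒯.tiles x y P Q f g
  base : Arms.Base 𝒯.tiles x P Q f β

namespace Race

variable {𝒯 : TAS A} {s x y : ℤ × ℤ} {P Q : List (ℤ × ℤ)} {f g β : Config A}

theorem swap (R : Race 𝒯 s x y P Q f g β) : Race 𝒯 s x y Q P g f β :=
  ⟨R.comp.swap, R.dirDet, R.seeded, R.derives, R.arms.swap, R.base.swap R.arms⟩

theorem start_mem (R : Race 𝒯 s x y P Q f g β) : x ∈ dom β := by
  show β x ≠ none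
  rw [R.base.start]
  exact R.arms.pathL.2.2.1 x (List.mem_of_mem_take (R.arms.start_mem_take 0))

theorem seed_mem (R : Race 𝒯 s x y P Q f g β) : s ∈ dom β := R.derives.sub.1 R.seeded.mem

theorem exists_path (R : Race 𝒯 s x y P Q f g β) :
    ∃ q, IsBindingPath β (q ++ [x]) ∧ FromTo s x (q ++ [x]) := by
  obtain ⟨p, hp, hp'⟩ := R.base.stable.exists_path R.seed_mem R.start_mem
  obtain ⟨q, rfl⟩ := List.getLast?_eq_some_iff.1 hp'.2
  exact ⟨q, hp, hp'⟩

theorem eq_cons (R : Race 𝒯 s x y P Q f g β) : ∃ r, P = x :: r := by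
  have := R.arms.endsL.1
  cases P with
  | nil => simp at this
  | cons a r => simp at this; exact ⟨r, by rw [this]⟩

/-- In an assembly above `β`, the paths from `x` inside `P ∪ Q` are prefixes of `P` or `Q`. -/
theorem follows (R : Race 𝒯 s x y P Q f g β) {γ δ : Config A} (hδ : 𝒯.Producible δ)
    (hβ : Sub β δ) (hγ : Sub γ δ) (hd : ∀ v ∈ dom γ, v ∈ P ∨ v ∈ Q) : TAS.Follows x P Q γ := by
  intro p hp hx
  obtain ⟨q, hq, hq'⟩ := R.exists_path
  obtain ⟨p, rfl⟩ : ∃ r, p = x :: r := by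
    cases p with
    | nil => simp at hx
    | cons a r => simp at hx; exact ⟨r, by rw [hx]⟩
  -- Starting at the seed, the path becomes subject to the conditions on `𝒯`; it is simple because
  -- `β` meets `P` and `Q` only at `x`.
  have hpath : IsBindingPath δ (q ++ x :: p) := by
    refine (hq.mono hβ).append (hp.mono hγ) fun v hv hv' => ?_
    have := R.base.inter v (hd v (hp.2.2.1 v (by simp [hv]))) (hq.2.2.1 v hv')
    subst this
    exact (List.nodup_cons.1 hp.2.1).1 hv
  obtain ⟨v, hv⟩ : ∃ v, (x :: p).getLast? = some v := by simp [List.getLast?_cons]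
  have hft : FromTo s v (q ++ x :: p) := by
    refine ⟨?_, by rw [List.getLast?_append, hv]; rfl⟩
    rw [← hq'.1]
    cases q <;> simp
  have key : ∀ W ∈ [P, Q], (∃ r, W = x :: r) → v ∈ W → v ≠ y → FromTo x y W → x :: p <+: W := by
    rintro W hW ⟨r, rfl⟩ hvW hvy hends
    obtain ⟨m, hm, rfl⟩ := List.mem_iff_getElem.1 hvW
    have hm' : m + 1 < (x :: r).length := by
      by_contra hn
      exact hvy (hends.getElem_last (by omega))
    have := (R.comp.inner δ hδ _ hW m _ hm' (List.getElem?_eq_getElem hm) _ hpath hft).1 (by simp)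
    rw [List.take_succ_cons] at this
    rw [← eq_of_cons_isSuffix hpath.2.1 this, ← List.take_succ_cons]
    exact List.take_prefix _ _
  by_cases hvy : v = y
  · subst hvy
    obtain ⟨W, hW, hsuf⟩ := R.comp.final δ hδ _ hpath hft
    simp only [List.mem_cons, List.not_mem_nil, or_false] at hW
    rcases hW with rfl | rfl
    · obtain ⟨r, rfl⟩ := R.eq_cons
      rw [eq_of_cons_isSuffix hpath.2.1 hsuf]
      exact .inl (List.prefix_refl _)
    · obtain ⟨r, rfl⟩ := R.swap.eq_cons
      rw [eq_of_cons_isSuffix hpath.2.1 hsuf]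
      exact .inr (List.prefix_refl _)
  · rcases hd v (hp.2.2.1 v (List.mem_of_getLast? hv)) with h | h
    · exact .inl (key P (by simp) R.eq_cons h hvy R.arms.endsL)
    · exact .inr (key Q (by simp) R.swap.eq_cons h hvy R.arms.endsR)

/-- The two paths close a cycle: running along `P` to `y` and then one step backwards along `Q` is a
simple path from `x` that follows neither. The bound on `Q.length` keeps the penultimate point of
`Q` away from `x`. -/
theorem false_of_both_aux (R : Race 𝒯 s x y P Q f g β) {δ : Config A} (hδ : 𝒯.Producible δ)
    (hβ : Sub β δ) (hP : IsBindingPath δ P) (hQ : IsBindingPath δ Q) (hl : 3 ≤ Q.length) :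
    False := by
  classical
  set γ : Config A := fun v => if v ∈ P ∨ v ∈ Q then δ v else none with hγ
  have hγd : ∀ v ∈ dom γ, v ∈ P ∨ v ∈ Q := fun v hv => by
    by_contra hn
    exact hv (by simp only [hγ]; rw [if_neg hn])
  have hsub : Sub γ δ := sub_iff.2 fun v hv => by simp only [hγ]; rw [if_pos (hγd v hv)]
  have hF := R.follows hδ hβ hsub hγd
  have hP' : IsBindingPath γ P := hP.congr fun v hv => by simp [hγ, hv]
  have hQ' : IsBindingPath γ Q := hQ.congr fun v hv => by simp [hγ, hv]
  obtain ⟨n, hn⟩ : ∃ n, n + 1 + 1 = Q.length := ⟨Q.length - 2, by omega⟩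
  have hlast := R.arms.endsR.getElem_last hn
  have hz : Q[n] ∉ P := fun hzP => by
    rcases R.arms.meet _ hzP (List.getElem_mem (by omega)) with e | e
    · have := R.arms.swap.next_ne_start (j := n - 1) (by omega)
      simp only [show n - 1 + 1 = n by omega] at this
      exact this e
    · rw [← hlast, R.arms.pathR.2.1.getElem_inj_iff] at e; omega
  have hadj : (bindingGraph γ).Adj y Q[n] := by
    have := (List.isChain_iff_getElem.1 hQ'.2.2.2 n (by omega)).symm
    rwa [hlast] at this
  have hpath : IsBindingPath γ (P ++ [Q[n]]) := by
    refine ⟨by simp, ?_, ?_, ?_⟩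
    · exact hP'.2.1.append (by simp) (by simpa using hz)
    · intro v hv
      rcases List.mem_append.1 hv with h | h
      · exact hP'.2.2.1 v h
      · rw [List.mem_singleton.1 h]; exact adj_mem_dom_right hadj
    · rw [List.isChain_append]
      refine ⟨hP'.2.2.2, by simp, ?_⟩
      rw [R.arms.endsL.2]
      simpa using hadj
  have hhead : (P ++ [Q[n]]).head? = some x := by
    rw [List.head?_append_of_ne_nil _ hP.1]; exact R.arms.endsL.1
  rcases hF _ hpath hhead with h | h
  · have := h.length_le; simp at this
  -- A prefix of `Q` that contains `y` before its last point would make `y` occur twice in `Q`.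
  · obtain ⟨r, hr⟩ := h
    have hy : y ∈ [Q[n]] ++ r := by
      have h2 := R.arms.endsR.2
      rw [← hr, List.append_assoc, List.getLast?_append_of_ne_nil _ (by simp)] at h2
      exact List.mem_of_getLast? h2
    have hnd := R.arms.pathR.2.1
    rw [← hr, List.append_assoc, List.nodup_append] at hnd
    exact hnd.2.2 y (List.mem_of_getLast? R.arms.endsL.2) y hy rfl

/-- Two paths of two points with the same ends would coincide. -/
theorem exists_three_le (R : Race 𝒯 s x y P Q f g β) : 3 ≤ P.length ∨ 3 ≤ Q.length := by
  have h1 := R.arms.lenL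
  have h2 := R.arms.swap.lenL
  by_contra! hn
  refine R.comp.ne_paths (List.ext_getElem (by omega) fun i hi hi' => ?_)
  obtain rfl | rfl : i = 0 ∨ i = 1 := by omega
  · rw [R.arms.endsL.getElem_zero, R.arms.endsR.getElem_zero]
  · rw [R.arms.endsL.getElem_last (by omega), R.arms.endsR.getElem_last (by omega)]

/-- An assembly above `β` cannot contain both paths. -/
theorem false_of_both (R : Race 𝒯 s x y P Q f g β) {δ : Config A} (hδ : 𝒯.Producible δ)
    (hβ : Sub β δ) (hP : IsBindingPath δ P) (hQ : IsBindingPath δ Q) : False := by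
  rcases R.exists_three_le with h | h
  · exact R.swap.false_of_both_aux hδ hβ hQ hP h
  · exact R.false_of_both_aux hδ hβ hP hQ h

theorem derives_left (R : Race 𝒯 s x y P Q f g β) {j k : ℕ} (hj : j < P.length)
    (hk : k + 1 < Q.length) : Derives 𝒯.tiles 𝒯.seed (overlay (merge P Q f g j k) β) :=
  R.derives.trans (R.arms.derives_left R.base hj hk)

theorem follows_left (R : Race 𝒯 s x y P Q f g β) {j k : ℕ} (hj : j < P.length)
    (hk : k + 1 < Q.length) : TAS.Follows x P Q (merge P Q f g j k) :=
  R.follows (R.derives_left hj hk).producible (sub_overlay_right (R.arms.agree_base R.base))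
    sub_overlay_left fun _ => R.arms.mem_of_mem_dom_merge

theorem follows_swap {x : ℤ × ℤ} {P Q : List (ℤ × ℤ)} {γ : Config A} :
    TAS.Follows x P Q γ ↔ TAS.Follows x Q P γ :=
  ⟨fun h p hp hx => (h p hp hx).symm, fun h p hp hx => (h p hp hx).symm⟩

/-- Equality would place `P[j + 1]` on the right arm, so both steps would fill `y`, and with the
same tile; the common assembly would contain both complete paths. -/
theorem merge_ne_merge (R : Race 𝒯 s x y P Q f g β) {j k : ℕ} (hj : j + 1 < P.length)
    (hk : k + 1 < Q.length) : merge P Q f g (j + 1) k ≠ merge P Q f g j (k + 1) := by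
  intro e
  have h1 : P[j + 1] ∈ dom (merge P Q f g j (k + 1)) := by
    rw [← e, R.arms.dom_merge]
    left
    rw [getElem_mem_take_iff R.arms.pathL.2.1]; omega
  rw [R.arms.dom_merge] at h1
  rcases h1 with h1 | h1
  · rw [getElem_mem_take_iff R.arms.pathL.2.1] at h1; omega
  · rcases R.arms.meet _ (List.getElem_mem hj) (List.mem_of_mem_take h1) with e' | e'
    · exact R.arms.next_ne_start hj e'
    · rw [e', R.arms.swap.end_mem_take] at h1
      have hj' : j + 1 + 1 = P.length := by
        have := R.arms.end_mem_take (j + 1)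
        rw [← e', getElem_mem_take_iff R.arms.pathL.2.1] at this
        have := this.1 (by omega)
        omega
      have hb := R.arms.isBindingPath_right hj (k := k + 1) (by omega)
      rw [← e] at hb
      refine R.false_of_both (R.derives_left hj hk).producible
        (sub_overlay_right (R.arms.agree_base R.base))
        ((R.arms.isBindingPath_left hj').mono sub_overlay_left) (hb.mono sub_overlay_left)

end Race

/-! ### Directional determinism and the continuations of a state -/

/-- In a directionally deterministic system, tiles that attach at the same point to agreeing
assemblies, and bind there to the same tile at the same side, are equal. -/
theorem TAS.DirDet.tile_eq {𝒯 : TAS A} {s p v : ℤ × ℤ} (h : 𝒯.DirDet s) (hp : p ≠ s)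
    {a b a' b' : Config A} {t t' : TileType A} (ha : Derives 𝒯.tiles 𝒯.seed a)
    (hb : Derives 𝒯.tiles 𝒯.seed b) (hat : Attach 𝒯.tiles a p t a')
    (hbt : Attach 𝒯.tiles b p t' b') (hab : Agree a b)
    (hv : p ∈ 𝒯.POC s → (bindingGraph a').Adj p v ∧ (bindingGraph b').Adj p v ∧ a v = b v) :
    t = t' := by
  by_contra hne
  have hpa : p ∈ dom a' := mem_dom.2 ⟨t, hat.2.2.2.2⟩
  have hdd := (h a' (Derives.producible (ha.tail ⟨_, _, hat⟩)) p hpa).resolve_left hp a b a' b' t t'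
    ha.producible hb.producible hat hbt
  by_cases hP : p ∈ 𝒯.POC s
  · obtain ⟨h1, h2, h3⟩ := hv hP
    have := hdd.1 hP hne (v - p) (v - p) (by simpa using h1) (by simpa using h2)
    simp [h3] at this
  · exact hdd.2 hP hne hab

namespace Race

variable {𝒯 : TAS A} {s x y : ℤ × ℤ} {P Q : List (ℤ × ℤ)} {f g β : Config A}

theorem next_ne_seed (R : Race 𝒯 s x y P Q f g β) {j : ℕ} (hj : j + 1 < P.length) :
    P[j + 1] ≠ s := fun e =>
  R.arms.next_ne_start hj
    (R.base.inter _ (.inl (List.getElem_mem hj)) (by rw [e]; exact R.seed_mem))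

theorem merge_getElem (R : Race 𝒯 s x y P Q f g β) {j k m : ℕ} (hm : m < P.length) (hmj : m ≤ j) :
    P[m] ∈ dom (merge P Q f g j k) ∧ merge P Q f g j k P[m] = f P[m] := by
  have : P[m] ∈ P.take (j + 1) := by rw [getElem_mem_take_iff R.arms.pathL.2.1]; omega
  exact ⟨by rw [R.arms.dom_merge]; exact .inl this, Arms.merge_left this⟩

theorem adj_overlay (R : Race 𝒯 s x y P Q f g β) {j k m : ℕ} (hm : m + 1 < P.length)
    (hmj : m + 1 ≤ j) :
    (bindingGraph (overlay (merge P Q f g j k) β)).Adj P[m + 1] P[m] := by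
  have h1 := R.merge_getElem (k := k) hm hmj
  have h2 := R.merge_getElem (j := j) (k := k) (m := m) (by omega) (by omega)
  exact adj_congr (List.isChain_iff_getElem.1 R.arms.pathL.2.2.2 m hm).symm
    (by rw [overlay_of_mem h1.1, h1.2]) (by rw [overlay_of_mem h2.1, h2.2])

/-- Laid over `β`, the attachment takes place in `𝒯`. There it is compared with the attachment of
the tile of `f` to the same assembly, which binds at the same side to the same tile. -/
theorem attach_eq_merge (R : Race 𝒯 s x y P Q f g β) {j k : ℕ} (hj : j + 1 < P.length)
    (hk : k + 1 < Q.length) {t : TileType A} {γ : Config A}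
    (h : Attach 𝒯.tiles (merge P Q f g j k) P[j + 1] t γ)
    (hadj : (bindingGraph γ).Adj P[j + 1] P[j]) : γ = merge P Q f g (j + 1) k := by
  have hd := R.derives_left (j := j) (by omega) hk
  have hst := hd.stable R.seeded.stable
  obtain ⟨t', ht', hat'⟩ := R.arms.attach_merge R.base hj hk hst
  have hadj2 : (bindingGraph (overlay γ β)).Adj P[j + 1] P[j] := sub_overlay_left.adj hadj
  have hγ := h.eq_update
  rw [hγ, overlay_update] at hadj2
  have hnm : P[j + 1] ∉ dom (overlay (merge P Q f g j k) β) := by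
    rw [dom_overlay]
    rintro (h3 | h3)
    · exact R.arms.next_notMem hj hk h3
    · exact R.arms.next_ne_start hj (R.base.inter _ (.inl (List.getElem_mem hj)) h3)
  have hat := attach_update hst hnm h.mem_tiles hadj2
  have : t = t' := R.dirDet.tile_eq (v := P[j]) (R.next_ne_seed hj) hd hd hat hat'
    ((Sub.refl _).agree (Sub.refl _)) fun _ => ⟨hadj2, R.adj_overlay hj le_rfl, rfl⟩
  rw [hγ, R.arms.merge_succ hj, ht', this]

theorem attach_eq_merge_of_prefix (R : Race 𝒯 s x y P Q f g β) {j k m : ℕ}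
    (hj : j + 1 < P.length) (hk : k + 1 < Q.length) {p : ℤ × ℤ} {t : TileType A} {γ : Config A}
    (h : Attach 𝒯.tiles (merge P Q f g j k) p t γ) (hm : m < P.length) (hmj : m ≤ j)
    (hadj : (bindingGraph γ).Adj p P[m]) (hpre : P.take (m + 1) ++ [p] <+: P) :
    γ = merge P Q f g (j + 1) k := by
  have hlen : m + 1 < P.length := by have := hpre.length_le; simp at this; omega
  have hp : p = P[m + 1] := by
    have := hpre.getElem (i := m + 1) (by simp; omega)
    rw [← this, List.getElem_append_right (by simp)]
    simp
  subst hp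
  -- If `m < j`, the point `P[m + 1]` would already be occupied.
  obtain rfl : m = j := by
    by_contra hne
    exact h.notMem (R.merge_getElem hlen (by omega)).1
  exact R.attach_eq_merge hj hk h hadj

/-- The piece of `P` up to `v`, prolonged by `p`, is a path from `x`, hence a prefix of `P` or of
`Q`. In the first case `p` is the next point of `P`; in the second, `v = x` and the right arm makes
its first step. -/
theorem attach_eq_of_adj_left (R : Race 𝒯 s x y P Q f g β) {j k : ℕ}
    (hj : j + 1 < P.length) (hk : k + 1 < Q.length) {p v : ℤ × ℤ} {t : TileType A} {γ : Config A}
    (h : Attach 𝒯.tiles (merge P Q f g j k) p t γ) (hF : TAS.Follows x P Q γ)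
    (hv : v ∈ P.take (j + 1)) (hadj : (bindingGraph γ).Adj p v) :
    γ = merge P Q f g (j + 1) k ∨ γ = merge P Q f g j (k + 1) := by
  obtain ⟨m, hm, rfl⟩ := List.mem_take_iff_getElem.1 hv
  have hmP : m < P.length := by omega
  have hpath : IsBindingPath γ (P.take (m + 1) ++ [p]) := by
    have h1 : IsBindingPath (merge P Q f g j k) (P.take (m + 1)) :=
      (R.arms.pathL.infix (by simp; exact R.arms.pathL.1) (List.take_prefix _ _).isInfix).congr
        fun v hv => Arms.merge_left ((List.take_subset_take_left P (by omega)) hv)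
    refine ⟨by simp, ?_, ?_, ?_⟩
    · exact h1.2.1.append (by simp)
        (by simpa using fun hp : p ∈ P.take (m + 1) => h.notMem (h1.2.2.1 p hp))
    · intro v hv
      rcases List.mem_append.1 hv with h' | h'
      · exact h.2.2.1.1 (h1.2.2.1 v h')
      · rw [List.mem_singleton.1 h']; exact adj_mem_dom_left hadj
    · rw [List.isChain_append]
      refine ⟨(h1.mono h.2.2.1).2.2.2, by simp, ?_⟩
      intro a ha b hb
      rw [← List.take_append_getElem hmP, List.getLast?_append_of_ne_nil _ (by simp)] at ha
      simp only [List.getLast?_singleton, List.head?_cons, Option.mem_def,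
        Option.some.injEq] at ha hb
      subst ha hb
      exact hadj.symm
  have hhead : (P.take (m + 1) ++ [p]).head? = some x := by
    obtain ⟨r, hr⟩ := R.eq_cons
    rw [hr]; simp
  rcases hF _ hpath hhead with hpre | hpre
  · exact .inl (R.attach_eq_merge_of_prefix hj hk h hmP (by omega) hadj hpre)
  · right
    -- A longer piece of `P` would share `P[1]` with `Q`; this point is not `x`, nor `y`, because
    -- the left arm is incomplete.
    obtain rfl : m = 0 := by
      by_contra h0
      have h1 : P[0 + 1] ∈ P.take (m + 1) := by
        rw [getElem_mem_take_iff R.arms.pathL.2.1]; omega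
      rcases R.arms.meet _ (List.getElem_mem _) (hpre.subset (List.mem_append_left _ h1)) with e | e
      · exact R.arms.next_ne_start _ e
      · rw [e, R.arms.end_mem_take] at h1; omega
    have hx : P[0] = x := R.arms.endsL.getElem_zero _
    rw [R.arms.endsL.take_one, ← R.arms.endsR.take_one] at hpre
    rw [R.arms.merge_swap (.inl hj)] at h ⊢
    refine R.swap.attach_eq_merge_of_prefix hk hj h (m := 0) (by omega) (by omega) ?_ hpre
    rw [R.arms.endsR.getElem_zero, ← hx]
    exact hadj

/-- The two possible continuations of a competition. -/
theorem step_eq (R : Race 𝒯 s x y P Q f g β) {j k : ℕ} (hj : j + 1 < P.length)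
    (hk : k + 1 < Q.length) {γ : Config A} (h : Step 𝒯.tiles (merge P Q f g j k) γ)
    (hF : TAS.Follows x P Q γ) :
    γ = merge P Q f g (j + 1) k ∨ γ = merge P Q f g j (k + 1) := by
  obtain ⟨p, t, h⟩ := h
  obtain ⟨v, hv, hadj⟩ := h.exists_adj
  rw [R.arms.dom_merge] at hv
  rcases hv with hv | hv
  · exact R.attach_eq_of_adj_left hj hk h hF hv hadj
  · rw [R.arms.merge_swap (.inl hj)] at h
    have := R.swap.attach_eq_of_adj_left hk hj h (follows_swap.1 hF) hv hadj
    rw [← R.arms.merge_swap (.inl hj), ← R.arms.merge_swap (.inr hk)] at this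
    exact this.symm

end Race

/-! ### The tiles of the terminal assembly on the two paths -/

namespace Race

variable {𝒯 : TAS A} {s x y : ℤ × ℤ} {P Q : List (ℤ × ℤ)} {f g β α : Config A}

/-- A path of `b` from the seed to `P[m + 1]` arrives through `P[m]`. If it passes `x`, it ends with
a piece of `P`; if not, it is a prefix of a path to `x` inside `β`, which does not contain `P[m +
1]`. At `y`, arrival along `Q` is excluded because `α` contains `P`. -/
theorem arm_adj_of_attach (R : Race 𝒯 s x y P Q f g β) (hα : 𝒯.Producible α) (hβ : Sub β α)
    {m : ℕ} (hm : m + 1 < P.length) (hy : m + 2 = P.length → IsBindingPath α P) {b : Config A}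
    (hb : Derives 𝒯.tiles 𝒯.seed b) (hbα : Sub b α) (hp : P[m + 1] ∈ dom b) :
    (bindingGraph b).Adj P[m + 1] P[m] := by
  obtain ⟨p', hp', hft⟩ := (hb.stable R.seeded.stable).exists_path (hb.sub.1 R.seeded.mem) hp
  have key : ∀ n, m + 1 < n → P.take n <:+ p' → (bindingGraph b).Adj P[m + 1] P[m] := by
    intro n hn hsuf
    have h1 := List.isChain_iff_getElem.1 (hp'.2.2.2.infix hsuf.isInfix) m (by simp; omega)
    simpa using h1.symm
  by_cases hlast : m + 2 = P.length
  · have hpy : P[m + 1] = y := R.arms.endsL.getElem_last hlast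
    rw [hpy] at hft
    obtain ⟨W, hW, hsuf⟩ := R.comp.final b hb.producible p' hp' hft
    simp only [List.mem_cons, List.not_mem_nil, or_false] at hW
    rcases hW with rfl | rfl
    · exact key (m + 2) (by omega) (by rwa [List.take_of_length_le hlast.ge])
    · exact (R.false_of_both hα hβ (hy hlast)
        ((hp'.infix R.arms.pathR.1 hsuf.isInfix).mono hbα)).elim
  · have hin := R.comp.inner
    by_cases hx : x ∈ p'
    · exact key (m + 2) (by omega) ((hin b hb.producible P (by simp) (m + 1) _ (by omega)
        (List.getElem?_eq_getElem hm) p' hp' hft).1 hx)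
    · obtain ⟨q, hq, hq'⟩ := R.exists_path
      have := (hin α hα P (by simp) (m + 1) _ (by omega)
        (List.getElem?_eq_getElem hm) p' (hp'.mono hbα) hft).2 hx _ (hq.mono hβ) hq'
      have hmem := hq.2.2.1 _ (this.subset (List.mem_of_getLast? hft.2))
      exact absurd (R.base.inter _ (.inl (List.getElem_mem hm)) hmem) (R.arms.next_ne_start hm)

/-- When `P[m + 1]` is filled in a production of `α`, the tile binds to the one at `P[m]`. The
assembly just before and the state with `m` steps, laid over `β`, both lie below `α`; so they agree,
and directional determinism equates the two tiles. -/
theorem tile_eq_of_mem (R : Race 𝒯 s x y P Q f g β) (hα : 𝒯.Producible α) (hβ : Sub β α)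
    {m : ℕ} (hm : m + 1 < P.length) (hy : m + 2 = P.length → IsBindingPath α P)
    (hprev : ∀ i (hi : i ≤ m), α P[i] = f P[i]) (hp : P[m + 1] ∈ dom α) :
    α P[m + 1] = f P[m + 1] := by
  have hs : P[m + 1] ∉ dom 𝒯.seed := by rw [R.seeded.1]; exact R.next_ne_seed hm
  obtain ⟨a, b, t, ha, hat, hbα⟩ := hα.exists_attach hp hs
  have hb : Derives 𝒯.tiles 𝒯.seed b := .tail ha ⟨_, _, hat⟩
  have hQ := R.swap.arms.lenL
  have hd := R.derives_left (j := m) (k := 0) (by omega) (by omega)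
  obtain ⟨t', ht', hat'⟩ := R.arms.attach_merge R.base hm (k := 0) (by omega)
    (hd.stable R.seeded.stable)
  have hpb : P[m + 1] ∈ dom b := mem_dom.2 ⟨t, hat.2.2.2.2⟩
  have hadj := R.arm_adj_of_attach hα hβ hm hy hb hbα hpb
  have hsub : Sub (merge P Q f g m 0) α := by
    refine sub_iff.2 fun v hv => ?_
    have hv' : v ∈ P.take (m + 1) := by
      rw [R.arms.dom_merge] at hv
      rcases hv with hv | hv
      · exact hv
      · rw [R.arms.endsR.take_one, List.mem_singleton] at hv
        rw [hv]; exact R.arms.start_mem_take m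
    rw [Arms.merge_left hv']
    obtain ⟨i, hi, rfl⟩ := List.mem_take_iff_getElem.1 hv'
    exact hprev i (by omega)
  have hma : P[m] ∈ dom a := by
    by_contra hn
    have : P[m] ∈ dom b \ dom a := ⟨adj_mem_dom_right hadj, hn⟩
    rw [hat.2.2.2.1] at this
    exact hadj.ne' this
  have haα := hat.2.2.1.trans hbα
  have hmm := R.merge_getElem (j := m) (k := 0) (m := m) (by omega) le_rfl
  have : t = t' := R.dirDet.tile_eq (v := P[m]) (R.next_ne_seed hm) ha hd hat hat'
    (haα.agree (overlay_sub hsub hβ)) fun _ => ⟨hadj, R.adj_overlay hm le_rfl, by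
      rw [overlay_of_mem hmm.1, hmm.2, ← haα.eq hma, hprev m le_rfl]⟩
  rw [ht', ← this, ← hat.2.2.2.2, hbα.eq hpb]

/-- By induction along `P`: the next point is not vacant in `α`, since the tile of `f` could attach
there by binding to its predecessor. The end `y` is left out, as `α` may hold there the tile that
completes the other path. -/
theorem tile_eq_of_terminal (R : Race 𝒯 s x y P Q f g β) (hα : 𝒯.Terminal α) (hβ : Sub β α)
    {m : ℕ} (hm : m + 1 < P.length) : ∀ i (hi : i ≤ m), α P[i] = f P[i] := by
  induction m with
  | zero =>
    intro i hi
    obtain rfl : i = 0 := by omega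
    rw [R.arms.endsL.getElem_zero, hβ.eq R.start_mem, R.base.start]
  | succ m ih =>
    have ih := ih (by omega)
    intro i hi
    rcases Nat.lt_or_ge m i with h | h
    · obtain rfl : i = m + 1 := by omega
      refine R.tile_eq_of_mem hα.1 hβ (by omega) (fun h => by omega) ih ?_
      by_contra hn
      obtain ⟨t, ht⟩ := mem_dom.1 (R.arms.pathL.2.2.1 P[m + 1] (List.getElem_mem _))
      refine hα.2.2 ⟨_, _, t, attach_update hα.2.1 hn (R.arms.tilesL _ _ ht) (q := P[m]) ?_⟩
      have hadj := (List.isChain_iff_getElem.1 R.arms.pathL.2.2.2 m (by omega)).symm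
      refine adj_congr hadj (by simp [ht]) ?_
      rw [Function.update_of_ne hadj.ne']
      exact ih m le_rfl
    · exact ih i h

/-- The assemblies in which the left arm may be complete and the right arm is not are subassemblies
of a terminal assembly that contains the left arm. -/
theorem merge_sub (R : Race 𝒯 s x y P Q f g β) (hα : 𝒯.Terminal α) (hβ : Sub β α)
    (hP : IsBindingPath α P) {j k : ℕ} (hk : k + 1 < Q.length) :
    Sub (merge P Q f g j k) α := by
  have hlen := R.arms.lenL
  refine sub_iff.2 fun v hv => ?_
  by_cases hv' : v ∈ P.take (j + 1)
  · rw [Arms.merge_left hv']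
    obtain ⟨i, hi, rfl⟩ := List.mem_iff_getElem.1 (List.mem_of_mem_take hv')
    by_cases hlast : i + 1 = P.length
    · obtain ⟨m, rfl⟩ : ∃ m, i = m + 1 := ⟨i - 1, by omega⟩
      exact R.tile_eq_of_mem hα.1 hβ hi (fun _ => hP)
        (R.tile_eq_of_terminal hα hβ (by omega)) (hP.2.2.1 _ (List.getElem_mem _))
    · exact R.tile_eq_of_terminal hα hβ (m := i) (by omega) i le_rfl
  · rw [R.arms.dom_merge] at hv
    have hvQ := hv.resolve_left hv'
    rw [R.arms.merge_right (.inr hk) hvQ]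
    obtain ⟨i, hi, rfl⟩ := List.mem_take_iff_getElem.1 hvQ
    exact R.swap.tile_eq_of_terminal hα hβ (m := i) (by omega) i le_rfl

end Race

/-! ### Unrigged competitions -/

/-- If `x` is attached last, then every other point is connected to the seed without `x`. -/
theorem exists_path_avoiding {T : Finset (TileType A)} {σ β : Config A} {s x : ℤ × ℤ}
    {l : List (Config A)} (hσ : IsStableAssembly T σ) (hs : s ∈ dom σ)
    (hl : IsFinSeqFrom T σ l) (hx : TerminatesAt l x) (hβ : l.getLast? = some β) :
    x ∈ dom β ∧ ∀ v ∈ dom β, v ≠ x → ∃ p, IsBindingPath β p ∧ FromTo s v p ∧ x ∉ p := by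
  rcases hx with ⟨a, rfl, ha⟩ | ⟨u, a, b, rfl, hab⟩
  · simp only [List.getLast?_singleton, Option.some.injEq] at hβ
    subst hβ
    rw [ha]
    exact ⟨rfl, fun v hv hne => absurd hv hne⟩
  · have e : u ++ [a, b] = u ++ [a] ++ [b] := by simp
    rw [e] at hl hβ
    rw [isFinSeqFrom_append_pair] at hl
    simp only [List.getLast?_append, List.getLast?_singleton, Option.some_or,
      Option.some.injEq] at hβ
    subst hβ
    have hx : x ∈ dom b \ dom a := by rw [hab]; rfl
    refine ⟨hx.1, fun v hv hne => ?_⟩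
    have hva : v ∈ dom a := by
      by_contra hn
      have : v ∈ dom b \ dom a := ⟨hv, hn⟩
      rw [hab] at this
      exact hne this
    have hder := hl.1.derives (β := a) (by simp)
    obtain ⟨p, hp, hp'⟩ := (hder.stable hσ).exists_path (hder.sub.1 hs) hva
    exact ⟨p, hp.mono hl.2.sub, hp', fun h => hx.2 (hp.2.2.1 x h)⟩

theorem IsBindingPath.erase {α : Config A} {p : List (ℤ × ℤ)} {x : ℤ × ℤ}
    (hp : IsBindingPath α p) (hx : x ∉ p) : IsBindingPath (Function.update α x none) p :=
  hp.congr fun v hv => Function.update_of_ne (by rintro rfl; exact hx hv) _ _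

theorem erase_sub {α : Config A} {x : ℤ × ℤ} : Sub (Function.update α x none) α := by
  refine sub_iff.2 fun v hv => ?_
  have : v ≠ x := by rintro rfl; simp [dom] at hv
  rw [Function.update_of_ne this]

/-- For an unrigged competition there is an assembly `β` on top of which both paths can grow. -/
theorem exists_base {𝒯 : TAS A} {s x y : ℤ × ℤ} {win lose : List (ℤ × ℤ)} {α : Config A}
    (hseed : 𝒯.SinglySeeded s) (hα : 𝒯.Producible α) (hcomp : 𝒯.Competing s x y win lose)
    (hwin : IsBindingPath α win) (hrig : ¬ 𝒯.Rigged s α x lose) :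
    ∃ β, Derives 𝒯.tiles 𝒯.seed β ∧ Sub β α ∧ x ∈ dom β ∧
      ∀ v, v ∈ win ∨ v ∈ lose → v ∈ dom β → v = x := by
  unfold TAS.Rigged at hrig
  push Not at hrig
  obtain ⟨l, β, hl, hterm, hlast, hsub, hno⟩ := hrig
  have hder := hl.derives hlast
  obtain ⟨hxβ, havoid⟩ := exists_path_avoiding hseed.stable hseed.mem hl hterm hlast
  have hgW := (hcomp.grid win (by simp)).2
  have hgL := (hcomp.grid lose (by simp)).2
  have hmem : ∀ W ∈ [win, lose], x ∈ W := by
    intro W hW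
    exact List.mem_of_head? (hcomp.grid W hW).2.1
  have hyno : ∀ δ, 𝒯.Producible δ → ∀ p, IsBindingPath δ p → FromTo s y p → x ∈ p := by
    intro δ hδ p hp hft
    obtain ⟨W, hW, hsuf⟩ := hcomp.final δ hδ p hp hft
    exact hsuf.subset (hmem W hW)
  -- Every path from the seed to `y` passes `x`, but `β` reaches its other points without `x`.
  have hy : y ∉ dom β := fun hy => by
    obtain ⟨p, hp, hft, hx⟩ := havoid y hy hcomp.ne_points.symm
    exact hx (hyno β hder.producible p hp hft)
  refine ⟨β, hder, hsub, hxβ, ?_⟩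
  rintro v (hv | hv) hvβ
  -- From `v` the winning path leads to `y` without returning to `x`. Together with a path to `v`
  -- that avoids `x`, it connects the seed to `y` in `α` with `x` erased; reachability there spares
  -- making the concatenation simple by hand.
  · by_contra hne
    obtain ⟨p, hp, hft, hx⟩ := havoid v hvβ hne
    obtain ⟨m, hm, rfl⟩ := List.mem_iff_getElem.1 hv
    have hxd : x ∉ win.drop m := by
      intro hxd
      obtain ⟨i, hi, he⟩ := List.mem_drop_iff_getElem.1 hxd
      have h0 : 0 < win.length := by omega
      rw [← hgW.getElem_zero h0, hwin.2.1.getElem_inj_iff] at he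
      obtain rfl : m = 0 := by omega
      exact hne (hgW.getElem_zero h0)
    have h1 := ((hp.mono hsub).erase hx).reachable hft
    have h2 := ((hwin.infix (q := win.drop m) (by simp; omega)
      (List.drop_suffix _ _).isInfix).erase hxd).reachable (a := win[m]) (b := y)
      ⟨by rw [List.head?_drop, List.getElem?_eq_getElem hm], by
        rw [List.getLast?_drop, if_neg (by omega)]; exact hgW.2⟩
    obtain ⟨q, hq, hq'⟩ := exists_path_of_reachable (h1.trans h2)
      (((hp.mono hsub).erase hx).2.2.1 s (List.mem_of_head? hft.1))
    have hxq := hyno α hα q (hq.mono erase_sub) hq'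
    have := hq.2.2.1 x hxq
    simp [dom] at this
  -- Failure of rigging gives a path `q` from the seed to `x` that misses `v`, whereas the path to
  -- `v` avoiding `x` must be a prefix of `q`.
  · by_contra hne
    obtain ⟨p, hp, hft, hx⟩ := havoid v hvβ hne
    obtain ⟨m, hm, rfl⟩ := List.mem_iff_getElem.1 hv
    have hm0 : 0 < m := by
      rcases Nat.eq_zero_or_pos m with rfl | h
      · exact absurd (hgL.getElem_zero hm) hne
      · exact h
    have hml : m + 1 < lose.length := by
      by_contra hn
      have := hgL.getElem_last (n := m) (by omega)
      exact hy (this ▸ hvβ)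
    obtain ⟨q, hq, hq', hnq⟩ := hno m _ hm0 hml (List.getElem?_eq_getElem hm) hvβ
    have := (hcomp.inner β hder.producible lose (by simp) m _ hml (List.getElem?_eq_getElem hm)
      p hp hft).2 hx q hq hq'
    exact hnq (this.subset (List.mem_of_getLast? hft.2))

theorem dom_single {α : Config A} {x : ℤ × ℤ} (hx : x ∈ dom α) : dom (single α x) = {x} := by
  ext v
  by_cases h : v = x
  · subst h; simpa [dom, single] using hx
  · simp [dom, single, h]

theorem single_stable {T : Finset (TileType A)} {α : Config A} {x : ℤ × ℤ}
    (h : IsStableAssembly T α) (hx : x ∈ dom α) : IsStableAssembly T (single α x) :=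
  isStableAssembly_of_dom_eq_singleton (dom_single hx) fun t ht =>
    h.2.1 x t (by simpa [single] using ht)

/-- An unrigged competition gives a race whose arms grow on top of a subassembly of `α`. -/
theorem exists_race {𝒯 : TAS A} {s x y : ℤ × ℤ} {win lose : List (ℤ × ℤ)} {α : Config A}
    (hseed : 𝒯.SinglySeeded s) (hdir : 𝒯.DirDet s) (hα : 𝒯.Producible α)
    (hst : IsStableAssembly 𝒯.tiles α)
    (hcomp : 𝒯.Competing s x y win lose)
    (hwin : IsBindingPath α win) (hrig : ¬ 𝒯.Rigged s α x lose) :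
    ∃ f g β, Race 𝒯 s x y win lose f g β ∧ Sub β α := by
  obtain ⟨β, hder, hsub, hxβ, hinter⟩ := exists_base hseed hα hcomp hwin hrig
  have hxα := hsub.1 hxβ
  have hs := single_stable hst hxα
  have key : ∀ p ∈ [win, lose], ∃ f, IsBindingPath f p ∧ (∀ v t, f v = some t → t ∈ 𝒯.tiles) ∧
      f x = α x := by
    intro p hp
    obtain ⟨l, f, hl, hlast, -, hf⟩ := hcomp.isolated α hα hxα p hp
    have hd := hl.derives hlast
    refine ⟨f, hf, (hd.stable hs).2.1, ?_⟩
    rw [hd.sub.eq (p := x) (by rw [dom_single hxα]; rfl)]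
    simp [single]
  obtain ⟨f, hf, hfT, hfx⟩ := key win (by simp)
  obtain ⟨g, hg, hgT, hgx⟩ := key lose (by simp)
  refine ⟨f, g, β, ⟨hcomp, hdir, hseed, hder, ⟨hcomp.ne_points, hf, hg,
    (hcomp.grid win (by simp)).2, (hcomp.grid lose (by simp)).2, ?_, hfT, hgT, hfx.trans hgx.symm⟩,
    ⟨hder.stable hseed.stable, ?_, hinter⟩⟩, hsub⟩
  · intro v h1 h2
    have : v ∈ ({x, y} : Set (ℤ × ℤ)) := by rw [← hcomp.inter]; exact ⟨h1, h2⟩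
    exact this
  · rw [hfx, hsub.eq hxβ]

/-! ### Histories in a grid of states -/

/-- The words with `a` letters `true` and `b` letters `false`. -/
def words : ℕ → ℕ → Finset (List Bool)
  | 0, b => {List.replicate b false}
  | a + 1, 0 => {List.replicate (a + 1) true}
  | a + 1, b + 1 =>
    (words a (b + 1)).image (List.cons true) ∪ (words (a + 1) b).image (List.cons false)

theorem mem_words {a b : ℕ} {w : List Bool} :
    w ∈ words a b ↔ w.count true = a ∧ w.count false = b := by
  induction w generalizing a b with
  | nil =>
    match a, b with
    | 0, 0 => simp [words]
    | 0, b + 1 => simp [words, List.replicate_succ]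
    | a + 1, 0 => simp [words, List.replicate_succ]
    | a + 1, b + 1 => simp [words]
  | cons c w ih =>
    have h0 : ∀ {n : ℕ} {d : Bool}, w = List.replicate n d ↔ w.count (!d) = 0 ∧ w.count d = n := by
      intro n d
      constructor
      · rintro rfl; simp [List.count_replicate]
      · rintro ⟨h1, h2⟩
        rw [List.eq_replicate_iff]
        have hall : ∀ e ∈ w, e = d := fun e he => by
          by_contra hne
          have : e = !d := by cases e <;> cases d <;> simp_all
          exact List.count_eq_zero.1 h1 (this ▸ he)
        exact ⟨by rw [← h2]; exact (List.count_eq_length.2 fun e he => (hall e he).symm).symm, hall⟩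
    match a, b with
    | 0, 0 => cases c <;> simp [words]
    | 0, b + 1 => cases c <;> simp [words, List.replicate_succ, h0]
    | a + 1, 0 => cases c <;> simp [words, List.replicate_succ, h0, and_comm]
    | a + 1, b + 1 => cases c <;> simp [words, ih]

theorem card_words (a b : ℕ) : (words a b).card = (a + b).choose a := by
  induction a, b using words.induct with
  | case1 b => simp [words]
  | case2 a => simp [words]
  | case3 a b ih1 ih2 =>
    rw [words, Finset.card_union_of_disjoint, Finset.card_image_of_injective _ List.cons_injective,
      Finset.card_image_of_injective _ List.cons_injective, ih1, ih2,
      show a + 1 + (b + 1) = (a + (b + 1)) + 1 by ring, Nat.choose_succ_succ,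
      show a + (b + 1) = a + 1 + b by ring]
    rw [Finset.disjoint_left]
    intro w h1 h2
    obtain ⟨u, -, rfl⟩ := Finset.mem_image.1 h1
    obtain ⟨v, -, hv⟩ := Finset.mem_image.1 h2
    simp at hv

/-- The sequence of the states visited by a walk in the grid `M` of states. The word of the walk is
written from right to left; `true` increases the first coordinate, `false` the second one. -/
def history {X : Type*} (M : ℕ → ℕ → X) : List Bool → List X
  | [] => [M 0 0]
  | c :: w => history M w ++ [M ((c :: w).count true) ((c :: w).count false)]

theorem history_eq_append {X : Type*} (M : ℕ → ℕ → X) (w : List Bool) :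
    ∃ u, history M w = u ++ [M (w.count true) (w.count false)] := by
  cases w with
  | nil => exact ⟨[], rfl⟩
  | cons c w => exact ⟨_, rfl⟩

theorem history_cons_true {X : Type*} (M : ℕ → ℕ → X) (w : List Bool) :
    history M (true :: w) = history M w ++ [M (w.count true + 1) (w.count false)] := by
  simp [history]

theorem history_cons_false {X : Type*} (M : ℕ → ℕ → X) (w : List Bool) :
    history M (false :: w) = history M w ++ [M (w.count true) (w.count false + 1)] := by
  simp [history]

theorem length_history {X : Type*} (M : ℕ → ℕ → X) (w : List Bool) :
    (history M w).length = w.length + 1 := by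
  induction w with
  | nil => rfl
  | cons c w ih => simp [history, ih]

/-- A word leads to a state in the rectangle `[0, a) × [0, b)`. -/
def Within (a b : ℕ) (w : List Bool) : Prop := w.count true < a ∧ w.count false < b

theorem Within.of_cons {a b : ℕ} {c : Bool} {w : List Bool} (h : Within a b (c :: w)) :
    Within a b w :=
  ⟨List.count_le_count_cons.trans_lt h.1, List.count_le_count_cons.trans_lt h.2⟩

/-- Once the earlier letters are known, the last state determines the last letter, because the two
continuations of a state differ. No other states need be distinct. -/
theorem history_injOn {X : Type*} {M : ℕ → ℕ → X} {a b : ℕ}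
    (hM : ∀ j < a, ∀ k < b, M (j + 1) k ≠ M j (k + 1)) {w w' : List Bool} (hw : Within a b w)
    (hw' : Within a b w') (h : history M w = history M w') : w = w' := by
  induction w generalizing w' with
  | nil =>
    have := congrArg List.length h
    rw [length_history, length_history] at this
    exact (List.length_eq_zero_iff.1 (by simpa using this.symm)).symm
  | cons c w ih =>
    cases w' with
    | nil =>
      have := congrArg List.length h
      rw [length_history, length_history] at this
      simp at this
    | cons c' w' =>
      obtain ⟨h1, h2⟩ := List.append_inj' h rfl
      obtain rfl := ih hw.of_cons hw'.of_cons h1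
      have hb := hM _ hw.of_cons.1 _ hw.of_cons.2
      cases c <;> cases c' <;> simp at h2
      · rfl
      · exact absurd h2.symm hb
      · exact absurd h2 hb
      · rfl

theorem nodeProb_append {X : Type*} (N : Set (List X)) {l : List X} (hl : l ≠ []) (b : X) :
    nodeProb N (l ++ [b]) = nodeProb N l * (1 / ((children N l).ncard : ℝ)) := by
  have h1 : 1 ≤ l.length := List.length_pos_of_ne_nil hl
  unfold nodeProb
  rw [List.length_append, List.length_singleton, Finset.prod_Ico_succ_top h1]
  congr 1
  · refine Finset.prod_congr rfl fun k hk => ?_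
    rw [List.take_append_of_le_length (Finset.mem_Ico.1 hk).2.le]
  · rw [List.take_left']
    rfl

/-- If every state in the rectangle has the two continuations to its upper and right neighbours, a
history has probability `2⁻ⁿ`, where `n` is the number of its steps. -/
theorem nodeProb_history {X : Type*} {M : ℕ → ℕ → X} {N : Set (List X)} {a b : ℕ}
    (hM : ∀ j < a, ∀ k < b, M (j + 1) k ≠ M j (k + 1))
    (hN : ∀ w, Within a b w → children N (history M w) =
      {history M (true :: w), history M (false :: w)}) {w : List Bool} (hw : Within a b w) (c : Bool) :
    nodeProb N (history M (c :: w)) = (1 / 2 : ℝ) ^ (w.length + 1) := by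
  -- Only the word before the last letter has to stay in the rectangle: the final step may leave it,
  -- and its target need not branch.
  have hcard : (children N (history M w)).ncard = 2 := by
    rw [hN w hw, Set.ncard_pair]
    rw [history_cons_true, history_cons_false]
    intro h
    exact hM _ hw.1 _ hw.2 (by simpa using h)
  have hne : history M w ≠ [] := by obtain ⟨u, hu⟩ := history_eq_append M w; simp [hu]
  rw [history, nodeProb_append N hne, hcard, pow_succ]
  congr 1
  · cases w with
    | nil => simp [history, nodeProb]
    | cons d w => exact nodeProb_history hM hN hw.of_cons d

/-! ### Winning assembly sequences and their probability -/

namespace Race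

variable {𝒯 : TAS A} {s x y : ℤ × ℤ} {P Q : List (ℤ × ℤ)} {f g β α : Config A}

theorem base_single (R : Race 𝒯 s x y P Q f g β) (hst : IsStableAssembly 𝒯.tiles α)
    (hβ : Sub β α) : Arms.Base 𝒯.tiles x P Q f (single α x) := by
  have hx := hβ.1 R.start_mem
  refine ⟨single_stable hst hx, ?_, fun v _ hv => ?_⟩
  · simp [single, hβ.eq R.start_mem, R.base.start]
  · rw [dom_single hx] at hv; exact hv

theorem overlay_single (R : Race 𝒯 s x y P Q f g β) (hβ : Sub β α) (j k : ℕ) :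
    overlay (merge P Q f g j k) (single α x) = merge P Q f g j k := by
  funext v
  by_cases h : v ∈ dom (merge P Q f g j k)
  · exact overlay_of_mem h
  · rw [overlay_of_notMem h, not_not.1 h]
    by_contra hv
    have : v ∈ dom (single α x) := hv
    rw [dom_single (hβ.1 R.start_mem)] at this
    rw [R.arms.dom_merge] at h
    exact h (.inl ((this : v = x) ▸ R.arms.start_mem_take j))

theorem merge_zero (R : Race 𝒯 s x y P Q f g β) (hst : IsStableAssembly 𝒯.tiles α)
    (hβ : Sub β α) : merge P Q f g 0 0 = single α x := by
  rw [← R.overlay_single hβ, R.arms.overlay_zero (R.base_single hst hβ)]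

theorem merge_attach_left (R : Race 𝒯 s x y P Q f g β) (hst : IsStableAssembly 𝒯.tiles α)
    (hβ : Sub β α) {j k : ℕ} (hj : j + 1 < P.length) (hk : k + 1 < Q.length) :
    ∃ t, Attach 𝒯.tiles (merge P Q f g j k) P[j + 1] t (merge P Q f g (j + 1) k) := by
  have hB := R.base_single hst hβ
  obtain ⟨t, -, h⟩ := R.arms.attach_merge hB hj hk
    ((R.arms.derives_left hB (j := j) (by omega) hk).stable hB.stable)
  rw [R.overlay_single hβ, R.overlay_single hβ] at h
  exact ⟨t, h⟩

theorem merge_attach_right (R : Race 𝒯 s x y P Q f g β) (hst : IsStableAssembly 𝒯.tiles α)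
    (hβ : Sub β α) {j k : ℕ} (hj : j + 1 < P.length) (hk : k + 1 < Q.length) :
    ∃ t, Attach 𝒯.tiles (merge P Q f g j k) Q[k + 1] t (merge P Q f g j (k + 1)) := by
  rw [R.arms.merge_swap (.inl hj), R.arms.merge_swap (.inl hj)]
  exact R.swap.merge_attach_left hst hβ hk hj

theorem follows_right (R : Race 𝒯 s x y P Q f g β) {j k : ℕ} (hj : j + 1 < P.length)
    (hk : k < Q.length) : TAS.Follows x P Q (merge P Q f g j k) := by
  rw [R.arms.merge_swap (.inl hj)]
  exact follows_swap.1 (R.swap.follows_left hk hj)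

/-- The first claim for a non-empty word is the second one for its tail, hence the joint recursion.
-/
theorem history_isFinSeq (R : Race 𝒯 s x y P Q f g β) (hst : IsStableAssembly 𝒯.tiles α)
    (hβ : Sub β α) {w : List Bool} (hw : Within (P.length - 1) (Q.length - 1) w) :
    IsFinSeqFrom 𝒯.tiles (single α x) (history (merge P Q f g) w) ∧ ∀ c,
      IsFinSeqFrom 𝒯.tiles (single α x) (history (merge P Q f g) (c :: w)) := by
  have key : IsFinSeqFrom 𝒯.tiles (single α x) (history (merge P Q f g) w) → ∀ c,
      IsFinSeqFrom 𝒯.tiles (single α x) (history (merge P Q f g) (c :: w)) := by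
    intro h c
    obtain ⟨u, hu⟩ := history_eq_append (merge P Q f g) w
    obtain ⟨h1, h2⟩ := hw
    cases c
    · rw [history_cons_false, hu, isFinSeqFrom_append_pair, ← hu]
      obtain ⟨t, ht⟩ := R.merge_attach_right hst hβ (j := w.count true) (k := w.count false)
        (by omega) (by omega)
      exact ⟨h, _, _, ht⟩
    · rw [history_cons_true, hu, isFinSeqFrom_append_pair, ← hu]
      obtain ⟨t, ht⟩ := R.merge_attach_left hst hβ (j := w.count true) (k := w.count false)
        (by omega) (by omega)
      exact ⟨h, _, _, ht⟩
  have h : IsFinSeqFrom 𝒯.tiles (single α x) (history (merge P Q f g) w) := by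
    cases w with
    | nil => simp [history, IsFinSeqFrom, R.merge_zero hst hβ]
    | cons c w => exact (R.history_isFinSeq hst hβ hw.of_cons).2 c
  exact ⟨h, key h⟩

theorem children_history (R : Race 𝒯 s x y P Q f g β) (hst : IsStableAssembly 𝒯.tiles α)
    (hβ : Sub β α) {w : List Bool} (hw : Within (P.length - 1) (Q.length - 1) w) :
    children (𝒯.competitionNodes α x P Q) (history (merge P Q f g) w) =
      {history (merge P Q f g) (true :: w), history (merge P Q f g) (false :: w)} := by
  have h1 : w.count true + 1 < P.length := by have := hw.1; omega
  have h2 : w.count false + 1 < Q.length := by have := hw.2; omega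
  ext L
  constructor
  · rintro ⟨⟨hL, hF⟩, γ, rfl⟩
    obtain ⟨u, hu⟩ := history_eq_append (merge P Q f g) w
    replace hL : IsFinSeqFrom 𝒯.tiles (single α x) _ := hL
    rw [hu, isFinSeqFrom_append_pair] at hL
    rw [history_cons_true, history_cons_false]
    rcases R.step_eq h1 h2 hL.2 (hF γ (by simp)) with rfl | rfl
    · exact .inl rfl
    · exact .inr rfl
  · rintro (rfl | rfl)
    · refine ⟨⟨(R.history_isFinSeq hst hβ hw).2 true, ?_⟩, _, history_cons_true _ _⟩
      intro γ hγ
      rw [history_cons_true] at hγ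
      simp only [List.getLast?_append, List.getLast?_singleton, Option.some_or,
        Option.some.injEq] at hγ
      exact hγ ▸ R.follows_left h1 h2
    · refine ⟨⟨(R.history_isFinSeq hst hβ hw).2 false, ?_⟩, _, history_cons_false _ _⟩
      intro γ hγ
      rw [history_cons_false] at hγ
      simp only [List.getLast?_append, List.getLast?_singleton, Option.some_or,
        Option.some.injEq] at hγ
      exact hγ ▸ R.follows_right h1 h2

theorem follows_mono {γ δ : Config A} (h : Sub γ δ) (hF : TAS.Follows x P Q δ) :
    TAS.Follows x P Q γ :=
  fun p hp hx => hF p (hp.mono h) hx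

theorem end_mem_merge_left (R : Race 𝒯 s x y P Q f g β) {j k : ℕ} (hk : k + 1 < Q.length) :
    y ∈ dom (merge P Q f g j k) ↔ P.length ≤ j + 1 := by
  rw [R.arms.dom_merge]
  show y ∈ P.take (j + 1) ∨ y ∈ Q.take (k + 1) ↔ _
  rw [R.arms.end_mem_take, R.arms.swap.end_mem_take]
  omega

theorem end_mem_merge_right (R : Race 𝒯 s x y P Q f g β) {j k : ℕ} (hj : j + 1 < P.length) :
    y ∈ dom (merge P Q f g j k) ↔ Q.length ≤ k + 1 := by
  rw [R.arms.merge_swap (.inl hj), R.swap.end_mem_merge_left hj]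

/-- While `y` is vacant neither arm is complete, so `step_eq` applies to each step and contributes
one letter. -/
theorem exists_history (R : Race 𝒯 s x y P Q f g β) (hst : IsStableAssembly 𝒯.tiles α)
    (hβ : Sub β α) {L : List (Config A)} {γ : Config A}
    (hL : IsFinSeqFrom 𝒯.tiles (single α x) (L ++ [γ])) (hF : TAS.Follows x P Q γ)
    (hy : y ∉ dom γ) :
    ∃ w, Within (P.length - 1) (Q.length - 1) w ∧ L ++ [γ] = history (merge P Q f g) w := by
  have hP := R.arms.lenL
  have hQ := R.swap.arms.lenL
  induction L using List.reverseRecOn generalizing γ with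
  | nil =>
    refine ⟨[], ⟨by simp; omega, by simp; omega⟩, ?_⟩
    have := hL.1
    simp only [List.nil_append, List.head?_cons, Option.some.injEq] at this
    rw [this, history, R.merge_zero hst hβ]
    rfl
  | append_singleton L δ ih =>
    rw [isFinSeqFrom_append_pair] at hL
    obtain ⟨w, hw, hLw⟩ := ih hL.1 (follows_mono hL.2.sub hF) fun h => hy (hL.2.sub.1 h)
    have h1 : w.count true + 1 < P.length := by have := hw.1; omega
    have h2 : w.count false + 1 < Q.length := by have := hw.2; omega
    obtain ⟨u, hu⟩ := history_eq_append (merge P Q f g) w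
    obtain ⟨-, e⟩ := List.append_inj' (hLw.trans hu) rfl
    simp only [List.cons.injEq, and_true] at e
    have hstep := hL.2
    rw [e] at hstep
    rcases R.step_eq h1 h2 hstep hF with rfl | rfl
    · rw [R.end_mem_merge_left h2] at hy
      exact ⟨true :: w, ⟨by simp; omega, by simp; omega⟩, by rw [history_cons_true, hLw]⟩
    · rw [R.end_mem_merge_right h1] at hy
      exact ⟨false :: w, ⟨by simp; omega, by simp; omega⟩, by rw [history_cons_false, hLw]⟩

/-- Before the last attachment `y` is vacant, so the sequence is a history. The last step fills `y`,
and it completes the left arm: completing the right one below `α` would put both paths into `α`.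
Conversely, `merge_sub` places such results below `α`. -/
theorem mem_winningSeqs (R : Race 𝒯 s x y P Q f g β) (hα : 𝒯.Terminal α) (hβ : Sub β α)
    (hP : IsBindingPath α P) {L : List (Config A)} :
    L ∈ 𝒯.winningSeqs α x y P Q ↔ ∃ w : List Bool, w.count true = P.length - 2 ∧
      w.count false < Q.length - 1 ∧ L = history (merge P Q f g) (true :: w) := by
  have hlP := R.arms.lenL
  constructor
  · rintro ⟨hL, hterm, γ, hγ, -, hγP, hsub, hF⟩
    replace hL : IsFinSeqFrom 𝒯.tiles (single α x) _ := hL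
    rcases hterm with ⟨a, rfl, ha⟩ | ⟨u, a, b, rfl, hab⟩
    · have := hL.1
      simp only [List.head?_cons, Option.some.injEq] at this
      rw [this, dom_single (hβ.1 R.start_mem), Set.singleton_eq_singleton_iff] at ha
      exact absurd ha R.arms.ne
    · have e : u ++ [a, b] = u ++ [a] ++ [b] := by simp
      rw [e] at hL hγ ⊢
      simp only [List.getLast?_append, List.getLast?_singleton, Option.some_or,
        Option.some.injEq] at hγ
      subst hγ
      rw [isFinSeqFrom_append_pair] at hL
      have hy : y ∈ dom b \ dom a := by rw [hab]; rfl
      obtain ⟨w, hw, hLw⟩ := R.exists_history hα.2.1 hβ hL.1 (follows_mono hL.2.sub hF) hy.2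
      have h1 : w.count true + 1 < P.length := by have := hw.1; omega
      have h2 : w.count false + 1 < Q.length := by have := hw.2; omega
      obtain ⟨v, hv⟩ := history_eq_append (merge P Q f g) w
      obtain ⟨-, e'⟩ := List.append_inj' (hLw.trans hv) rfl
      simp only [List.cons.injEq, and_true] at e'
      have hstep := hL.2
      rw [e'] at hstep
      have hyb := hy.1
      rcases R.step_eq h1 h2 hstep hF with rfl | rfl
      · rw [R.end_mem_merge_left h2] at hyb
        exact ⟨w, by omega, by omega, by rw [history_cons_true, hLw]⟩
      · rw [R.end_mem_merge_right h1] at hyb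
        exact (R.false_of_both hα.1 hβ hP
          ((R.arms.isBindingPath_right h1 (by omega)).mono hsub)).elim
  · rintro ⟨w, hw1, hw2, rfl⟩
    have hw : Within (P.length - 1) (Q.length - 1) w := ⟨by omega, hw2⟩
    have hfin := (R.history_isFinSeq hα.2.1 hβ hw).2 true
    have hlast : (history (merge P Q f g) (true :: w)).getLast? =
        some (merge P Q f g (w.count true + 1) (w.count false)) := by
      rw [history_cons_true]; simp
    obtain ⟨u, hu⟩ := history_eq_append (merge P Q f g) w
    refine ⟨hfin, .inr ⟨u, merge P Q f g (w.count true) (w.count false),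
      merge P Q f g (w.count true + 1) (w.count false), ?_, ?_⟩, _, hlast,
      Derives.producible (𝒯 := 𝒯.competition α x) (hfin.derives hlast),
      R.arms.isBindingPath_left (by omega), R.merge_sub hα hβ hP (by omega),
      R.follows_left (by omega) (by omega)⟩
    · rw [history_cons_true, hu]; simp
    · obtain ⟨t, ht⟩ := R.merge_attach_left hα.2.1 hβ (j := w.count true) (k := w.count false)
        (by omega) (by omega)
      rw [ht.2.2.2.1, R.arms.endsL.getElem_last (by omega)]

theorem competitionProb_eq (R : Race 𝒯 s x y P Q f g β) (hα : 𝒯.Terminal α) (hβ : Sub β α)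
    (hP : IsBindingPath α P) :
    𝒯.competitionProb α x y P Q = ∑ k ∈ Finset.range (Q.length - 1),
      ((P.length + k - 2).choose (P.length - 2) : ℝ) * (1 / 2 : ℝ) ^ (P.length + k - 1) := by
  classical
  have hlP := R.arms.lenL
  have hM : ∀ j < P.length - 1, ∀ k < Q.length - 1,
      merge P Q f g (j + 1) k ≠ merge P Q f g j (k + 1) :=
    fun j hj k hk => R.merge_ne_merge (by omega) (by omega)
  -- The words without the final letter `true`, which fills `y`; hence `P.length - 2` letters
  -- `true`. They are grouped by the number `k` of tiles placed on the losing path.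
  set W := (Finset.range (Q.length - 1)).biUnion (words (P.length - 2)) with hW
  have hmemW : ∀ w, w ∈ W ↔ w.count true = P.length - 2 ∧ w.count false < Q.length - 1 := by
    intro w
    simp only [hW, Finset.mem_biUnion, Finset.mem_range, mem_words]
    exact ⟨fun ⟨k, hk, h1, h2⟩ => ⟨h1, h2 ▸ hk⟩, fun h => ⟨_, h.2, h.1, rfl⟩⟩
  have hwin : ∀ w ∈ W, Within (P.length - 1) (Q.length - 1) w := fun w hw => by
    have := (hmemW w).1 hw
    exact ⟨by omega, this.2⟩
  have hset : 𝒯.winningSeqs α x y P Q =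
      ↑(W.image fun w => history (merge P Q f g) (true :: w)) := by
    ext L
    rw [R.mem_winningSeqs hα hβ hP, Finset.coe_image]
    constructor
    · rintro ⟨w, h1, h2, rfl⟩
      exact ⟨w, (hmemW w).2 ⟨h1, h2⟩, rfl⟩
    · rintro ⟨w, hw, rfl⟩
      exact ⟨w, ((hmemW w).1 hw).1, ((hmemW w).1 hw).2, rfl⟩
  unfold TAS.competitionProb
  rw [hset, Finset.tsum_subtype' _ (nodeProb (𝒯.competitionNodes α x P Q)), Finset.sum_image,
    hW, Finset.sum_biUnion]
  · refine Finset.sum_congr rfl fun k hk => ?_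
    rw [Finset.sum_congr rfl (g := fun _ => (1 / 2 : ℝ) ^ (P.length + k - 1)), Finset.sum_const,
      card_words, nsmul_eq_mul, show P.length - 2 + k = P.length + k - 2 by omega]
    intro w hw
    rw [nodeProb_history hM (fun w hw => R.children_history hα.2.1 hβ hw)
      (hwin w (Finset.mem_biUnion.2 ⟨k, hk, hw⟩))]
    rw [mem_words] at hw
    have := List.count_true_add_count_false w
    rw [show w.length + 1 = P.length + k - 1 by omega]
  · intro k _ k' _ hkk
    rw [Function.onFun, Finset.disjoint_left]
    intro w h1 h2
    rw [mem_words] at h1 h2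
    exact hkk (h1.2.symm.trans h2.2)
  · intro w hw w' hw' h
    simp only [history_cons_true] at h
    exact history_injOn hM (hwin w hw) (hwin w' hw') (List.append_inj' h rfl).1

end Race

end TileAssembly

theorem mainTheorem2 {A : Type*} (𝒯 : TileAssembly.TAS A) (s : ℤ × ℤ) {r : ℕ}
    (y : Fin r → ℤ × ℤ) (w : Fin r → TileAssembly.TileType A) (α : TileAssembly.Config A)
    (h𝒯 : 𝒯.SeqNonDet s y w α)
    (i : Fin r) (x : ℤ × ℤ) (win lose : List (ℤ × ℤ))
    (hcomp : 𝒯.Competing s x (y i) win lose) (hwin : 𝒯.IsWinningPath α x win lose)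
    (hrig : ¬ 𝒯.Rigged s α x lose)
    (l l' : ℕ) (hl : win.length = l) (hl' : lose.length = l') (hl2 : 2 ≤ l) (hl2' : 2 ≤ l') :
    𝒯.competitionProb α x (y i) win lose =
      ∑ k ∈ Finset.range (l' - 1),
        ((l + k - 2).choose (l - 2) : ℝ) * (1 / 2 : ℝ) ^ (l + k - 1) := by
  obtain ⟨γ, -, hγ, hsub, -⟩ := hwin
  have hP := hγ.mono hsub
  obtain ⟨f, g, β, R, hβ⟩ := TileAssembly.exists_race h𝒯.seeded h𝒯.dirDet h𝒯.terminal.1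
    h𝒯.terminal.2.1 hcomp hP hrig
  subst hl hl'
  exact R.competitionProb_eq h𝒯.terminal hβ hP
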